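/- **Conventions.** Let $M$ be a finite monoid and $k$ a field. For $x,y\in M$ write $x\mathcal L y$ if $Mx=My$, $x\mathcal R y$ if $xM=yM$, $x\mathcal H y$ if both hold, and $x\mathcal D y$ if $x\mathcal L z$ and $z\mathcal R y$ for some $z\in M$. The $\mathcal D$-classes are partially ordered by $D_x\le D_y\iff x\in MyM$. For a $\mathcal D$-class $D$ put $D^2=\{xy: x,y\in D\}\subseteq M\subseteq k[M]$ and $\hat A^D=\bigoplus_{D'<D}k[D']\subseteq k[M]$. Choose a base element $\gamma_D\in D$, let $H$ be the $\mathcal H$-class of $\gamma_D$, and let $G_D=\{r_m: m\in M,\ Hm\subseteq H\}$ be the (right) Schützenberger group of $D$, where $r_m:H\to H$, $h\mapsto hm$, and $r_mr_n=r_{mn}$ (up to isomorphism $G_D$ does not depend on $\gamma_D$). The monoid $M$ is regular if for every $x\in M$ there is $y\in M$ with $x=xyx$. A *cell algebra* structure on a unital associative $k$-algebra $A$ consists of a finite poset $\Lambda$, finite sets $L(\lambda),R(\lambda)$ for $\lambda\in\Lambda$, and a $k$-basis $\{{}_sC^\lambda_t:\lambda\in\Lambda,\ s\in L(\lambda),\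 t\in R(\lambda)\}$ of $A$ such that, with $\hat A^\lambda=\operatorname{span}\{{}_sC^\mu_t:\mu>\lambda\}$, for all $a\in A$ and $\lambda\in\Lambda$: * for each $s\in L(\lambda)$ there are $r_{s'}\in k$ with $a\cdot{}_sC^\lambda_t\equiv\sum_{s'\in L(\lambda)}r_{s'}\,{}_{s'}C^\lambda_t \pmod{\hat A^\lambda}$ for all $t\in R(\lambda)$; * for each $t\in R(\lambda)$ there are $r_{t'}\in k$ with ${}_sC^\lambda_t\cdot a\equiv\sum_{t'\in R(\lambda)}r_{t'}\,{}_sC^\lambda_{t'} \pmod{\hat A^\lambda}$ for all $s\in L(\lambda)$. Let ${}_LC^\lambda$ and $C_R^\lambda$ be the $k$-vector spaces with bases $\{{}_sC^\lambda: s\in L(\lambda)\}$ and $\{C^\lambda_t: t\in R(\lambda)\}$. There is a bilinear form $\langle\cdot,\cdot\rangle: C_R^\lambda\times{}_LC^\lambda\to k$ determined by ${}_{s'}C^\lambda_t\cdot{}_sC^\lambda_{t'}\equiv\langle C^\lambda_t,{}_sC^\lambda\rangle\,{}_{s'}C^\lambda_{t'}\pmod{\hat A^\lambda}$ for all $s,s'\in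 L(\lambda)$, $t,t'\in R(\lambda)$. Let $\Lambda_0$ be the set of all $\lambda\in\Lambda$ for which this form is not identically zero. A finite-dimensional $k$-algebra $A$ is *quasi-hereditary* if there is a chain of two-sided ideals $0=J_0\subseteq J_1\subseteq\dots\subseteq J_n=A$ such that, for each $i<n$, $J=J_{i+1}/J_i$ is a heredity ideal of $B=A/J_i$, that is, $J^2=J$, $J\operatorname{rad}(B)J=0$, and $J$ is projective as a left $B$-module. **Corollary.** Let $k$ be a field and $M$ a finite monoid such that, for every $\mathcal D$-class $D$ of $M$, the group algebra $k[G_D]$ of the Schützenberger group of $D$ has a cell algebra structure with $(\Lambda_D)_0=\Lambda_D$. 1. If $M$ is regular, then $k[M]$ is quasi-hereditary. 2. More generally, if $D^2\not\subseteq\hat A^D$ for every $\mathcal D$-class $D$ of $M$, then $k[M]$ is quasi-hereditary. -/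

import Mathlib

open scoped Pointwise

namespace MonoidCell

/-! ### Green's relations on a monoid -/

section Green

variable {M : Type*} [Monoid M]

/-- `x 𝓛 y` iff `M x = M y`. -/
def GreenL (x y : M) : Prop := Set.range (fun m : M => m * x) = Set.range (fun m : M => m * y)

/-- `x 𝓡 y` iff `x M = y M`. -/
def GreenR (x y : M) : Prop := Set.range (fun m : M => x * m) = Set.range (fun m : M => y * m)

/-- `x 𝓗 y` iff `x 𝓛 y` and `x 𝓡 y`. -/
def GreenH (x y : M) : Prop := GreenL x y ∧ GreenR x y

/-- `x 𝓓 y` iff `x 𝓛 z` and `z 𝓡 y` for some `z`. -/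
def GreenD (x y : M) : Prop := ∃ z : M, GreenL x z ∧ GreenR z y

/-- The `𝓗`-class of `x`. -/
def hClass (x : M) : Set M := {y | GreenH x y}

/-- The `𝓓`-class of `x`. -/
def dClass (x : M) : Set M := {y | GreenD x y}

variable (M) in
/-- The set of all `𝓓`-classes of `M`. -/
def DClass : Type _ := {D : Set M // ∃ x : M, D = dClass x}

/-- The underlying set of a `𝓓`-class. -/
def DClass.carrier (D : DClass M) : Set M := D.1

/-- `D_x ≤ D_y` iff `x ∈ M y M`. -/
def DClass.Le (D E : DClass M) : Prop :=
  ∃ x ∈ D.carrier, ∃ y ∈ E.carrier, ∃ a b : M, x = a * y * b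

/-- The strict order `D < E`. -/
def DClass.Lt (D E : DClass M) : Prop := D.Le E ∧ D ≠ E

variable (M) in
/-- `M` is regular if every `x` has some `y` with `x = x y x`. -/
def IsRegularMonoid : Prop := ∀ x : M, ∃ y : M, x = x * y * x

/-- `Â^D`, the span in `k[M]` of all `𝓓`-classes strictly below `D`. -/
noncomputable def hatD (k : Type*) [Field k] (D : DClass M) : Submodule k (MonoidAlgebra k M) :=
  Submodule.span k {a | ∃ D' : DClass M, D'.Lt D ∧ ∃ m ∈ D'.carrier, a = MonoidAlgebra.of k M m}

/-- The condition `D² ⊆ Â^D`, where `D² = {x y : x, y ∈ D}` is regarded as a subset of `k[M]`. -/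
def SqSubsetHat (k : Type*) [Field k] (D : DClass M) : Prop :=
  MonoidAlgebra.of k M '' (D.carrier * D.carrier) ⊆ (hatD k D : Set (MonoidAlgebra k M))

/-! ### The (right) Schützenberger group -/

/-- `RT(H) = {m : H m ⊆ H}`. -/
def RT (H : Set M) : Submonoid M where
  carrier := {m | ∀ h ∈ H, h * m ∈ H}
  mul_mem' := fun {a b} ha hb h hh => by
    rw [← mul_assoc]
    exact hb _ (ha _ hh)
  one_mem' := fun h hh => by rwa [mul_one]

/-- `m ↦ r_m`, with `(h) r_m = h m`. The target is the opposite of the monoid of self-maps of `H`,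
since maps written on the right are composed from left to right: `r_m r_n = r_{mn}`. -/
def rightTranslation (H : Set M) : RT H →* (Function.End H)ᵐᵒᵖ where
  toFun m := MulOpposite.op (fun h : H => (⟨h.1 * m.1, m.2 h.1 h.2⟩ : H))
  map_one' := by
    apply MulOpposite.unop_injective
    funext h
    exact Subtype.ext (mul_one _)
  map_mul' a b := by
    apply MulOpposite.unop_injective
    funext h
    exact Subtype.ext (mul_assoc _ _ _).symm

/-- The right Schützenberger group `{r_m : m ∈ RT(H)}` of the `𝓗`-class `H` of `γ`. -/
def SchutzenbergerGroup (γ : M) : Type _ := MonoidHom.mrange (rightTranslation (hClass γ))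

theorem SchutzenbergerGroup.exists_left_inv (γ : M)
    (g : MonoidHom.mrange (rightTranslation (hClass γ))) :
    ∃ g' : MonoidHom.mrange (rightTranslation (hClass γ)), g' * g = 1 := by
  obtain ⟨_, ⟨m, rfl⟩⟩ := g
  have hγ : γ ∈ hClass γ := ⟨rfl, rfl⟩
  obtain ⟨hL, hR⟩ := m.2 γ hγ
  obtain ⟨t, ht⟩ : ∃ t, γ * m.1 * t = γ := by
    have : γ ∈ Set.range (fun x : M => γ * x) := ⟨1, mul_one _⟩
    rw [hR] at this
    exact this
  obtain ⟨n, hn⟩ : ∃ n, n * (γ * m.1) = γ := by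
    have : γ ∈ Set.range (fun x : M => x * γ) := ⟨1, one_mul _⟩
    rw [hL] at this
    exact this
  obtain ⟨n', hn'⟩ : ∃ n', n' * γ = γ * m.1 := by
    have : γ * m.1 ∈ Set.range (fun x : M => x * (γ * m.1)) := ⟨1, one_mul _⟩
    rw [← hL] at this
    exact this
  have hcancel : ∀ h ∈ hClass γ, ∃ c, h = c * γ ∧ h * m.1 * t = h := by
    rintro h ⟨h1, -⟩
    have : h ∈ Set.range (fun x : M => x * h) := ⟨1, one_mul _⟩
    rw [← h1] at this
    obtain ⟨c, rfl⟩ := this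
    refine ⟨c, rfl, ?_⟩
    simp only [mul_assoc] at ht ⊢
    rw [ht]
  have hnγ : n * γ = γ * t := by
    calc n * γ = n * (γ * m.1 * t) := by rw [ht]
      _ = n * (γ * m.1) * t := by simp only [mul_assoc]
      _ = γ * t := by rw [hn]
  have htm : γ * t * m.1 = γ := by rw [← hnγ, mul_assoc, hn]
  have htRT : t ∈ RT (hClass γ) := by
    rintro h ⟨h1, h2⟩
    obtain ⟨c, rfl, -⟩ := hcancel h ⟨h1, h2⟩
    obtain ⟨d, hd⟩ : ∃ d, d * (c * γ) = γ := by
      have : γ ∈ Set.range (fun x : M => x * γ) := ⟨1, one_mul _⟩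
      rw [h1] at this
      exact this
    refine ⟨?_, ?_⟩
    · apply Set.Subset.antisymm
      · rintro _ ⟨x, rfl⟩
        refine ⟨x * n' * d, ?_⟩
        calc x * n' * d * (c * γ * t) = x * n' * (d * (c * γ)) * t := by simp only [mul_assoc]
          _ = x * (n' * γ) * t := by rw [hd]; simp only [mul_assoc]
          _ = x * (γ * m.1 * t) := by rw [hn']; simp only [mul_assoc]
          _ = x * γ := by rw [ht]
      · rintro _ ⟨x, rfl⟩
        refine ⟨x * c * n, ?_⟩
        calc x * c * n * γ = x * c * (n * γ) := by simp only [mul_assoc]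
          _ = x * (c * γ * t) := by rw [hnγ]; simp only [mul_assoc]
    · unfold GreenR at h2 ⊢
      rw [h2]
      apply Set.Subset.antisymm
      · rintro _ ⟨x, rfl⟩
        refine ⟨m.1 * x, ?_⟩
        calc c * γ * t * (m.1 * x) = c * (γ * t * m.1) * x := by simp only [mul_assoc]
          _ = c * γ * x := by rw [htm]
      · rintro _ ⟨x, rfl⟩
        exact ⟨t * x, by simp only [mul_assoc]⟩
  refine ⟨⟨_, ⟨⟨t, htRT⟩, rfl⟩⟩, Subtype.ext (MulOpposite.unop_injective ?_)⟩
  funext h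
  obtain ⟨c, hc, -⟩ := hcancel h.1 h.2
  refine Subtype.ext ?_
  change h.1 * t * m.1 = h.1
  rw [hc]
  calc c * γ * t * m.1 = c * (γ * t * m.1) := by simp only [mul_assoc]
    _ = c * γ := by rw [htm]

noncomputable instance (γ : M) : Group (SchutzenbergerGroup γ) where
  toMonoid := inferInstanceAs (Monoid (MonoidHom.mrange (rightTranslation (hClass γ))))
  inv := fun g => (SchutzenbergerGroup.exists_left_inv γ g).choose
  inv_mul_cancel := fun g => (SchutzenbergerGroup.exists_left_inv γ g).choose_spec

end Green

/-! ### Cell algebras -/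

/-- A cell algebra structure on the `R`-algebra `A`: a finite poset `Λ`, finite sets of left and
right indices, and an `R`-basis `C` of `A` satisfying the two cell conditions. The index sets are
finite, so taking them in `Type` loses nothing. -/
structure CellStructure (R A : Type*) [CommRing R] [Ring A] [Algebra R A] where
  /-- The poset. -/
  Λ : Type
  [finΛ : Finite Λ]
  [poset : PartialOrder Λ]
  /-- The left indices. -/
  L : Λ → Type
  /-- The right indices. -/
  Rt : Λ → Type
  [fintypeL : ∀ l, Fintype (L l)]
  [fintypeRt : ∀ l, Fintype (Rt l)]
  /-- The cell basis. -/
  C : Module.Basis (Σ l : Λ, L l × Rt l) R A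
  left_mul : ∀ (a : A) (l : Λ) (s : L l), ∃ r : L l → R, ∀ t : Rt l,
    a * C ⟨l, s, t⟩ - ∑ s' : L l, r s' • C ⟨l, s', t⟩ ∈
      Submodule.span R {x | ∃ m : Λ, l < m ∧ ∃ (p : L m) (q : Rt m), x = C ⟨m, p, q⟩}
  right_mul : ∀ (a : A) (l : Λ) (t : Rt l), ∃ r : Rt l → R, ∀ s : L l,
    C ⟨l, s, t⟩ * a - ∑ t' : Rt l, r t' • C ⟨l, s, t'⟩ ∈
      Submodule.span R {x | ∃ m : Λ, l < m ∧ ∃ (p : L m) (q : Rt m), x = C ⟨m, p, q⟩}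

namespace CellStructure

attribute [instance] finΛ poset fintypeL fintypeRt

variable {R A : Type*} [CommRing R] [Ring A] [Algebra R A] (c : CellStructure R A)

/-- `Â^λ`, the span of the basis elements with index strictly greater than `λ`. -/
def hat (l : c.Λ) : Submodule R A :=
  Submodule.span R {x | ∃ m : c.Λ, l < m ∧ ∃ (p : c.L m) (q : c.Rt m), x = c.C ⟨m, p, q⟩}

/-- The left cell module of `λ` as an `R`-module: free on the left indices. -/
abbrev LeftCell (l : c.Λ) : Type _ := c.L l → R

/-- The right cell module of `λ` as an `R`-module: free on the right indices. -/
abbrev RightCell (l : c.Λ) : Type _ := c.Rt l → R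

/-- The bracket `⟨C_t, _sC⟩` of basis vectors, read off as the coefficient of `_sC_t` in
`_sC_t · _sC_t`; see `basisBracket_spec` for the defining property. -/
noncomputable def basisBracket (l : c.Λ) (t : c.Rt l) (s : c.L l) : R :=
  c.C.repr (c.C ⟨l, s, t⟩ * c.C ⟨l, s, t⟩) ⟨l, s, t⟩

/-- The bracket `⟨x, y⟩` of `x` in the right cell module and `y` in the left cell module,
the `R`-bilinear extension of `basisBracket`. -/
noncomputable def bracket (l : c.Λ) (x : c.RightCell l) (y : c.LeftCell l) : R :=
  ∑ t : c.Rt l, ∑ s : c.L l, x t * y s * c.basisBracket l t s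

/-- `Λ₀`, the set of all `λ` whose bracket is not identically zero. -/
def Λ₀ : Set c.Λ := {l | ∃ (x : c.RightCell l) (y : c.LeftCell l), c.bracket l x y ≠ 0}

theorem repr_hat (l : c.Λ) {x : A} (hx : x ∈ c.hat l) (s : c.L l) (t : c.Rt l) :
    c.C.repr x ⟨l, s, t⟩ = 0 := by
  classical
  unfold hat at hx
  induction hx using Submodule.span_induction with
  | mem x hx =>
    obtain ⟨m, hm, p, q, rfl⟩ := hx
    rw [Module.Basis.repr_self, Finsupp.single_apply, if_neg]
    intro h
    exact hm.ne (congrArg Sigma.fst h).symm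
  | zero => simp
  | add x y _ _ hx hy => simp [hx, hy]
  | smul a x _ hx => simp [hx]

theorem repr_left (l : c.Λ) (r : c.L l → R) (t : c.Rt l) (s₁ : c.L l) :
    c.C.repr (∑ s' : c.L l, r s' • c.C ⟨l, s', t⟩) ⟨l, s₁, t⟩ = r s₁ := by
  classical
  simp [Finsupp.single_apply]

theorem repr_right (l : c.Λ) (r : c.Rt l → R) (s : c.L l) (t₁ : c.Rt l) :
    c.C.repr (∑ t' : c.Rt l, r t' • c.C ⟨l, s, t'⟩) ⟨l, s, t₁⟩ = r t₁ := by
  classical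
  simp [Finsupp.single_apply]

/-- `_{s'}C_t · _sC_{t'} = ⟨C_t, _sC⟩ _{s'}C_{t'}` modulo `Â^λ`, for all `s'` and `t'`. -/
theorem basisBracket_spec (l : c.Λ) (t : c.Rt l) (s : c.L l) (s' : c.L l) (t' : c.Rt l) :
    c.C ⟨l, s', t⟩ * c.C ⟨l, s, t'⟩ - c.basisBracket l t s • c.C ⟨l, s', t'⟩ ∈ c.hat l := by
  classical
  -- the coefficient of `_{p}C_{q}` in `_{p}C_t · _sC_q` does not depend on `p` and `q`
  have key : ∀ p q, c.C.repr (c.C ⟨l, p, t⟩ * c.C ⟨l, s, q⟩) ⟨l, p, q⟩ = c.basisBracket l t s := by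
    intro p q
    obtain ⟨r, hr⟩ := c.left_mul (c.C ⟨l, p, t⟩) l s
    obtain ⟨u, hu⟩ := c.right_mul (c.C ⟨l, s, t⟩) l t
    have h1 := c.repr_hat l (hr q) p q
    have h2 := c.repr_hat l (hr t) p t
    have h3 := c.repr_hat l (hu p) p t
    have h4 := c.repr_hat l (hu s) s t
    rw [map_sub, Finsupp.sub_apply, repr_left, sub_eq_zero] at h1 h2
    rw [map_sub, Finsupp.sub_apply, repr_right, sub_eq_zero] at h3 h4
    unfold basisBracket
    rw [h1, h4, ← h3, h2]
  obtain ⟨r, hr⟩ := c.left_mul (c.C ⟨l, s', t⟩) l s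
  obtain ⟨u, hu⟩ := c.right_mul (c.C ⟨l, s, t'⟩) l t
  have hr0 : ∀ p, p ≠ s' → r p = 0 := by
    intro p hp
    have h1 := c.repr_hat l (hr t') p t'
    have h2 := c.repr_hat l (hu s') p t'
    rw [map_sub, Finsupp.sub_apply, repr_left, sub_eq_zero] at h1
    rw [map_sub, Finsupp.sub_apply, sub_eq_zero] at h2
    rw [← h1, h2]
    simp [hp.symm]
  have hrs : r s' = c.basisBracket l t s := by
    have h1 := c.repr_hat l (hr t') s' t'
    rw [map_sub, Finsupp.sub_apply, repr_left, sub_eq_zero] at h1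
    rw [← h1, key]
  have h := hr t'
  rwa [Finset.sum_eq_single s' (fun p _ hp => by rw [hr0 p hp, zero_smul])
    (fun h => absurd (Finset.mem_univ _) h), hrs] at h

end CellStructure

/-- `A` is a cell algebra over `R` for some cell algebra structure with `Λ₀ = Λ`. -/
def IsFullCellAlgebra (R A : Type*) [CommRing R] [Ring A] [Algebra R A] : Prop :=
  ∃ c : CellStructure R A, c.Λ₀ = Set.univ

/-! ### Quasi-hereditary algebras -/

/-- A two-sided ideal `J` of `A` is a heredity ideal if `J² = J`, `J rad(A) J = 0` and `J` is
projective as a left `A`-module. -/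
structure IsHeredityIdeal {A : Type*} [Ring A] (J : Ideal A) : Prop where
  twoSided : J.IsTwoSided
  sq_eq : J * J = J
  mul_rad_mul : ∀ x ∈ J, ∀ r ∈ Ring.jacobson A, ∀ y ∈ J, x * r * y = 0
  projective : Module.Projective A J

/-- A finite-dimensional `k`-algebra `A` is quasi-hereditary if there is a chain of two-sided
ideals `0 = J₀ ⊆ J₁ ⊆ ⋯ ⊆ Jₙ = A` such that `Jᵢ₊₁ / Jᵢ` is a heredity ideal of `A / Jᵢ`. -/
structure IsQuasiHereditary (k A : Type*) [Field k] [Ring A] [Algebra k A] : Prop where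
  finite : Module.Finite k A
  exists_chain : ∃ (n : ℕ) (J : ℕ → Ideal A) (_ : ∀ i, (J i).IsTwoSided),
    J 0 = ⊥ ∧ J n = ⊤ ∧ ∀ i < n, J i ≤ J (i + 1) ∧
      IsHeredityIdeal ((J (i + 1)).map (Ideal.Quotient.mk (J i)))

end MonoidCell

/-! The cell hypothesis matters only through one consequence: the order of each Schützenberger group
is invertible in `k`. A group algebra is symmetric, by the form reading off the coefficient of `1`.
In a symmetric cell algebra with nonzero brackets, cells can be adjoined one at a time from the top
of the poset. Once the cells above `l` span an ideal with central identity `e`, multiplying by `1 -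
e` makes the relations of cell `l` exact: `T s t * T p q = Φ t p • T s q`. Symmetry makes left and
right annihilators agree, and one nonzero entry of `Φ` then forces both kernels of `Φ` to vanish. So
`Φ` is invertible, and the layer behaves like a full matrix algebra: it has an identity and no
nonzero nil ideal. Hence `k[G]` has no nonzero nil ideal. If the characteristic divided `|G|`, the
sum of the group elements would generate one (`card_ne_zero_of_isFullCellAlgebra`).

On the monoid side, both hypotheses put an idempotent in every `𝓙`-class. Let `B` be the quotient of
`k[M]` by the span of a monoid ideal `S'`, where `S` is obtained from `S'` by adding the `𝓙`-class
of an idempotent `e`. The image `J` of the span of `S` equals `BeB`, so `J² = J`. By stability of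
finite monoids `eBe` is `k[G_e]`, semisimple by Maschke, so `e rad(B) e = 0` and `J rad(B) J = 0`.
As a left module `J` is a sum of copies of `Be`, one for each `𝓛`-class, so it is projective.
Removing maximal `𝓙`-classes from `M` one at a time gives the heredity chain. -/

namespace MonoidCell

/-! ### Matrix blocks inside an algebra -/

section Block

variable {k A L R : Type*} [Field k] [Ring A] [Algebra k A] [Fintype L] [Fintype R]

/-- The combination `∑ a s t • T s t` of a family of vectors with coefficient matrix `a`. -/
def blockSum (T : L → R → A) (a : Matrix L R k) : A := ∑ s, ∑ t, a s t • T s t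

theorem blockSum_mul (T : L → R → A) (Φ : Matrix R L k)
    (hT : ∀ s t p q, T s t * T p q = Φ t p • T s q) (a : Matrix L R k) (p : L) (q : R) :
    blockSum T a * T p q = ∑ s, (a * Φ) s p • T s q := by
  simp only [blockSum, Finset.sum_mul, smul_mul_assoc, hT, Matrix.mul_apply, Finset.sum_smul,
    smul_smul]

theorem mul_blockSum (T : L → R → A) (Φ : Matrix R L k)
    (hT : ∀ s t p q, T s t * T p q = Φ t p • T s q) (a : Matrix L R k) (p : L) (q : R) :
    T p q * blockSum T a = ∑ t, (Φ * a) q t • T p t := by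
  simp only [blockSum, Finset.mul_sum, mul_smul_comm, hT, Matrix.mul_apply, Finset.sum_smul,
    smul_smul]
  rw [Finset.sum_comm]
  simp only [mul_comm]

theorem exists_left_inverse [DecidableEq L] [DecidableEq R] (N : Matrix R L k)
    (h : ∀ v : L → k, (∀ q, ∑ s, N q s * v s = 0) → v = 0) : ∃ P : Matrix L R k, P * N = 1 := by
  obtain ⟨g, hg⟩ := LinearMap.exists_leftInverse_of_injective (Matrix.toLin' N) (by
    rw [LinearMap.ker_eq_bot']
    intro v hv
    exact h v fun q => congrFun hv q)
  refine ⟨LinearMap.toMatrix' g, ?_⟩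
  have := congrArg LinearMap.toMatrix' hg
  rwa [LinearMap.toMatrix'_comp, LinearMap.toMatrix'_toLin', LinearMap.toMatrix'_id] at this

/-- The index sets are not assumed equinumerous: a trivial kernel on each side gives a left and a
right inverse, and these coincide. -/
theorem exists_two_sided_inverse [DecidableEq L] [DecidableEq R] (Φ : Matrix R L k)
    (hr : ∀ w : R → k, (∀ p, ∑ t, w t * Φ t p = 0) → w = 0)
    (hl : ∀ v : L → k, (∀ q, ∑ s, Φ q s * v s = 0) → v = 0) :
    ∃ Ψ : Matrix L R k, Φ * Ψ = 1 ∧ Ψ * Φ = 1 := by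
  obtain ⟨P, hP⟩ := exists_left_inverse Φ hl
  obtain ⟨Q, hQ⟩ := exists_left_inverse Φ.transpose (fun v hv => hr v fun p => by
    simpa [Matrix.transpose_apply, mul_comm] using hv p)
  have hQ' : Φ * Q.transpose = 1 := by
    have := congrArg Matrix.transpose hQ
    rwa [Matrix.transpose_mul, Matrix.transpose_transpose, Matrix.transpose_one] at this
  have : P = Q.transpose := by
    calc P = P * (Φ * Q.transpose) := by rw [hQ', Matrix.mul_one]
      _ = Q.transpose := by rw [← Matrix.mul_assoc, hP, Matrix.one_mul]
  exact ⟨P, this ▸ hQ', hP⟩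

theorem blockSum_mul_of_inverse [DecidableEq L] (T : L → R → A) (Φ : Matrix R L k)
    (hT : ∀ s t p q, T s t * T p q = Φ t p • T s q) (Ψ : Matrix L R k) (h : Ψ * Φ = 1)
    (p : L) (q : R) : blockSum T Ψ * T p q = T p q := by
  rw [blockSum_mul T Φ hT, h]
  simp [Matrix.one_apply]

theorem mul_blockSum_of_inverse [DecidableEq R] (T : L → R → A) (Φ : Matrix R L k)
    (hT : ∀ s t p q, T s t * T p q = Φ t p • T s q) (Ψ : Matrix L R k) (h : Φ * Ψ = 1)
    (p : L) (q : R) : T p q * blockSum T Ψ = T p q := by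
  rw [mul_blockSum T Φ hT, h]
  simp [Matrix.one_apply]

/-- Multiplying by basis elements on both sides isolates each entry of `Φ * a * Φ` as the
coefficient of a single `T p q'`. The outer indices `p`, `q'` are free, so they can be chosen with
`Φ q' p ≠ 0`, which makes `T p q'` non-nilpotent. -/
theorem blockSum_eq_zero_of_isNilpotent [DecidableEq L] [DecidableEq R]
    (T : L → R → A) (Φ : Matrix R L k)
    (hT : ∀ s t p q, T s t * T p q = Φ t p • T s q) (hT0 : ∀ s t, T s t ≠ 0)
    (Ψ : Matrix L R k) (h₁ : Φ * Ψ = 1) (h₂ : Ψ * Φ = 1) (a : Matrix L R k)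
    (hnil : ∀ x y : A, IsNilpotent (x * blockSum T a * y)) : a = 0 := by
  suffices h : Φ * a * Φ = 0 by
    calc a = Ψ * (Φ * a * Φ) * Ψ := by
          rw [Matrix.mul_assoc Φ, ← Matrix.mul_assoc Ψ, h₂, Matrix.one_mul, Matrix.mul_assoc, h₁,
            Matrix.mul_one]
      _ = 0 := by rw [h, Matrix.mul_zero, Matrix.zero_mul]
  have hprod : ∀ p q p' q', T p q * blockSum T a * T p' q' = (Φ * a * Φ) q p' • T p q' := by
    intro p q p' q'
    rw [mul_blockSum T Φ hT, Finset.sum_mul]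
    simp only [smul_mul_assoc, hT, smul_smul, ← Finset.sum_smul]
    rw [← Matrix.mul_apply]
  ext q p'
  by_contra hc
  rw [Matrix.zero_apply] at hc
  have hΦ : ∃ q' p, Φ q' p ≠ 0 := by
    by_contra! h0
    have : Φ = 0 := by ext i j; exact h0 i j
    rw [this, Matrix.mul_zero] at hc
    exact hc rfl
  obtain ⟨q', p, hq⟩ := hΦ
  have hn := hnil (T p q) (T p' q')
  rw [hprod] at hn
  have hpow : ∀ n : ℕ, ((Φ * a * Φ) q p' • T p q') ^ (n + 1)
      = ((Φ * a * Φ) q p' ^ (n + 1) * Φ q' p ^ n) • T p q' := by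
    intro n
    induction n with
    | zero => simp
    | succ n ih =>
      rw [pow_succ, ih, smul_mul_smul_comm, hT, smul_smul]
      congr 1
      ring
  obtain ⟨n, hn⟩ := hn
  have h0 := hpow n
  rw [pow_succ, hn, zero_mul] at h0
  rcases smul_eq_zero.mp h0.symm with h | h
  · exact mul_ne_zero (pow_ne_zero _ hc) (pow_ne_zero _ hq) h
  · exact hT0 _ _ h

end Block

/-! ### Symmetric cell algebras with nonzero brackets -/

namespace CellStructure

variable {k A : Type*} [Field k] [Ring A] [Algebra k A] (c : CellStructure k A)

/-- The span of the cell basis elements with index in `U`. -/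
def cellSpan (U : Set c.Λ) : Submodule k A :=
  Submodule.span k {x | ∃ m ∈ U, ∃ (p : c.L m) (q : c.Rt m), x = c.C ⟨m, p, q⟩}

theorem C_mem_cellSpan {U : Set c.Λ} {m : c.Λ} (hm : m ∈ U) (p : c.L m) (q : c.Rt m) :
    c.C ⟨m, p, q⟩ ∈ c.cellSpan U := Submodule.subset_span ⟨m, hm, p, q, rfl⟩

theorem cellSpan_mono {U V : Set c.Λ} (h : U ⊆ V) : c.cellSpan U ≤ c.cellSpan V :=
  Submodule.span_mono fun _ ⟨m, hm, p, q, hx⟩ => ⟨m, h hm, p, q, hx⟩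

theorem hat_le_cellSpan {U : Set c.Λ} {l : c.Λ} (h : ∀ m, l < m → m ∈ U) :
    c.hat l ≤ c.cellSpan U :=
  Submodule.span_mono fun _ ⟨m, hm, p, q, hx⟩ => ⟨m, h m hm, p, q, hx⟩

/-- The cell condition holds only up to strictly larger cells, and an upper set contains these. -/
theorem mul_mem_cellSpan_left {U : Set c.Λ} (hU : IsUpperSet U) (a : A) {x : A}
    (hx : x ∈ c.cellSpan U) : a * x ∈ c.cellSpan U := by
  unfold cellSpan at hx
  induction hx using Submodule.span_induction with
  | mem x hx =>
    obtain ⟨m, hm, p, q, rfl⟩ := hx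
    obtain ⟨r, hr⟩ := c.left_mul a m p
    rw [← sub_add_cancel (a * c.C ⟨m, p, q⟩) (∑ s' : c.L m, r s' • c.C ⟨m, s', q⟩)]
    exact add_mem (c.hat_le_cellSpan (fun m' h => hU h.le hm) (hr q))
      (sum_mem fun s _ => Submodule.smul_mem _ _ (c.C_mem_cellSpan hm _ _))
  | zero => simp
  | add x y _ _ hx hy => rw [mul_add]; exact add_mem hx hy
  | smul r x _ hx => rw [mul_smul_comm]; exact Submodule.smul_mem _ _ hx

theorem mul_mem_cellSpan_right {U : Set c.Λ} (hU : IsUpperSet U) (a : A) {x : A}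
    (hx : x ∈ c.cellSpan U) : x * a ∈ c.cellSpan U := by
  unfold cellSpan at hx
  induction hx using Submodule.span_induction with
  | mem x hx =>
    obtain ⟨m, hm, p, q, rfl⟩ := hx
    obtain ⟨r, hr⟩ := c.right_mul a m q
    rw [← sub_add_cancel (c.C ⟨m, p, q⟩ * a) (∑ s' : c.Rt m, r s' • c.C ⟨m, p, s'⟩)]
    exact add_mem (c.hat_le_cellSpan (fun m' h => hU h.le hm) (hr p))
      (sum_mem fun s _ => Submodule.smul_mem _ _ (c.C_mem_cellSpan hm _ _))
  | zero => simp
  | add x y _ _ hx hy => rw [add_mul]; exact add_mem hx hy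
  | smul r x _ hx => rw [smul_mul_assoc]; exact Submodule.smul_mem _ _ hx

theorem repr_cellSpan {U : Set c.Λ} {l : c.Λ} (hl : l ∉ U) {x : A} (hx : x ∈ c.cellSpan U)
    (s : c.L l) (t : c.Rt l) : c.C.repr x ⟨l, s, t⟩ = 0 := by
  classical
  unfold cellSpan at hx
  induction hx using Submodule.span_induction with
  | mem x hx =>
    obtain ⟨m, hm, p, q, rfl⟩ := hx
    rw [Module.Basis.repr_self, Finsupp.single_apply, if_neg]
    intro h
    have h' : m = l := congrArg Sigma.fst h
    exact hl (h' ▸ hm)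
  | zero => simp
  | add x y _ _ hx hy => simp [hx, hy]
  | smul a x _ hx => simp [hx]

theorem repr_blockSum (l : c.Λ) (a : Matrix (c.L l) (c.Rt l) k) (s : c.L l) (t : c.Rt l) :
    c.C.repr (blockSum (fun s t => c.C ⟨l, s, t⟩) a) ⟨l, s, t⟩ = a s t := by
  classical
  simp only [blockSum, map_sum, map_smul, Module.Basis.repr_self, Finsupp.coe_finsetSum,
    Finset.sum_apply, Finsupp.smul_apply, Finsupp.single_apply, smul_eq_mul]
  rw [Finset.sum_eq_single s, Finset.sum_eq_single t]
  · simp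
  · intro b _ hb; simp [hb]
  · simp
  · intro b _ hb; simp [hb]
  · simp

theorem exists_basisBracket_ne_zero {l : c.Λ} (hl : l ∈ c.Λ₀) :
    ∃ t s, c.basisBracket l t s ≠ 0 := by
  by_contra! h
  obtain ⟨x, y, hxy⟩ := hl
  exact hxy (by simp [bracket, h])

/-- The ideal spanned by the cells in `U` is unital and contains no nonzero element generating a
nil ideal. -/
def IsUnitalNonNil (U : Set c.Λ) : Prop :=
  ∃ e ∈ c.cellSpan U, (∀ x ∈ c.cellSpan U, e * x = x ∧ x * e = x) ∧
    ∀ x ∈ c.cellSpan U, (∀ a b : A, IsNilpotent (a * x * b)) → x = 0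

-- The inductive step: a new minimal cell `l` is adjoined to an ideal that already has an identity
-- `e`. The complement `1 - e` kills the error terms, and the trace form makes the bracket matrix of
-- `l` invertible. The new identity is `e` plus that of the block.
set_option maxHeartbeats 1000000 in
theorem IsUnitalNonNil.of_diff_singleton (tr : A →ₗ[k] k) (htr : ∀ a b, tr (a * b) = tr (b * a))
    (hnd : ∀ a, (∀ b, tr (a * b) = 0) → a = 0) (U U' : Set c.Λ) (l : c.Λ) (hlc : l ∈ c.Λ₀)
    (hlU : l ∈ U) (hU : IsUpperSet U) (hU' : IsUpperSet U') (hUU' : U' = U \ {l})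
    (h : c.IsUnitalNonNil U') : c.IsUnitalNonNil U := by
  classical
  obtain ⟨e, he, heid, henil⟩ := h
  have hsub : U' ⊆ U := hUU' ▸ Set.sdiff_subset
  have hlU' : l ∉ U' := fun h => (hUU' ▸ h : l ∈ U \ {l}).2 rfl
  have hmem : ∀ m ∈ U, m ≠ l → m ∈ U' := fun m hm hml => hUU' ▸ ⟨hm, hml⟩
  have hle : c.cellSpan U' ≤ c.cellSpan U := c.cellSpan_mono hsub
  have hhat : c.hat l ≤ c.cellSpan U' :=
    c.hat_le_cellSpan fun m hm => hmem m (hU hm.le hlU) hm.ne'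
  -- Both sides equal `e * a * e`, since `e * a` and `a * e` lie in the ideal of which `e` is the
  -- identity.
  have hcomm : ∀ a, e * a = a * e := fun a => by
    rw [← (heid _ (c.mul_mem_cellSpan_left hU' a he)).1, ← mul_assoc,
      (heid _ (c.mul_mem_cellSpan_right hU' a he)).2]
  set f := 1 - e with hf
  have hfcomm : ∀ a, f * a = a * f := fun a => by rw [hf, sub_mul, mul_sub, hcomm]; simp
  have hfe : f * e = 0 := by rw [hf, sub_mul, (heid e he).1, one_mul, sub_self]
  have hff : f * f = f := by rw [hf, mul_sub, ← hf, hfe]; simp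
  have hfU' : ∀ x ∈ c.cellSpan U', f * x = 0 := fun x hx => by
    rw [hf, sub_mul, (heid x hx).1, one_mul, sub_self]
  have hsplit : ∀ x, x = e * x + f * x := fun x => by rw [hf, sub_mul, one_mul]; abel
  have heU' : ∀ x, e * x ∈ c.cellSpan U' := fun x => c.mul_mem_cellSpan_right hU' x he
  set T : c.L l → c.Rt l → A := fun s t => f * c.C ⟨l, s, t⟩ with hTdef
  set Φ : Matrix (c.Rt l) (c.L l) k := fun t s => c.basisBracket l t s with hΦ
  have hTU : ∀ s t, T s t ∈ c.cellSpan U := fun s t =>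
    c.mul_mem_cellSpan_left hU f (c.C_mem_cellSpan hlU s t)
  have hfT : ∀ s t, f * T s t = T s t := fun s t => by rw [hTdef, ← mul_assoc, hff]
  have hTmul : ∀ s t p q, T s t * T p q = Φ t p • T s q := by
    intro s t p q
    have h := hfU' _ (hhat (c.basisBracket_spec l t p s q))
    rw [mul_sub, sub_eq_zero, mul_smul_comm] at h
    calc T s t * T p q = f * (c.C ⟨l, s, t⟩ * f) * c.C ⟨l, p, q⟩ := by
          simp only [hTdef, mul_assoc]
      _ = f * (c.C ⟨l, s, t⟩ * c.C ⟨l, p, q⟩) := by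
          rw [← hfcomm, ← mul_assoc f f, hff, mul_assoc]
      _ = Φ t p • T s q := h
  have hTlin : ∀ a : Matrix (c.L l) (c.Rt l) k, blockSum T a = 0 → a = 0 := by
    intro a ha
    have h1 : blockSum T a = f * blockSum (fun s t => c.C ⟨l, s, t⟩) a := by
      simp only [blockSum, Finset.mul_sum, mul_smul_comm, hTdef]
    rw [h1] at ha
    have h2 := hsplit (blockSum (fun s t => c.C ⟨l, s, t⟩) a)
    rw [ha, add_zero] at h2
    ext s t
    rw [← c.repr_blockSum l a s t, h2, Matrix.zero_apply]
    exact c.repr_cellSpan hlU' (heU' _) s t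
  have hTne : ∀ s t, T s t ≠ 0 := by
    intro s t h
    have := hTlin (Matrix.single s t 1) (by
      simp only [blockSum]
      refine Finset.sum_eq_zero fun s' _ => Finset.sum_eq_zero fun t' _ => ?_
      by_cases h' : s = s' ∧ t = t'
      · rw [← h'.1, ← h'.2, h, smul_zero]
      · rw [Matrix.single_apply, if_neg h', zero_smul])
    simpa using congrFun (congrFun this s) t
  have hTspan : ∀ x ∈ c.cellSpan U, ∃ a : Matrix (c.L l) (c.Rt l) k, f * x = blockSum T a := by
    intro x hx
    unfold cellSpan at hx
    induction hx using Submodule.span_induction with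
    | mem x hx =>
      obtain ⟨m, hm, p, q, rfl⟩ := hx
      by_cases hml : m = l
      · subst hml
        refine ⟨Matrix.single p q 1, ?_⟩
        simp only [blockSum, Matrix.single_apply, ite_smul, one_smul, zero_smul]
        rw [Finset.sum_eq_single p, Finset.sum_eq_single q]
        · simp [hTdef]
        · intro b _ hb; simp [hb.symm]
        · simp
        · intro b _ hb; simp [hb.symm]
        · simp
      · exact ⟨0, by simp [blockSum, hfU' _ (c.C_mem_cellSpan (hmem m hm hml) p q)]⟩
    | zero => exact ⟨0, by simp [blockSum]⟩
    | add x y _ _ hx hy =>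
      obtain ⟨a, ha⟩ := hx
      obtain ⟨b, hb⟩ := hy
      exact ⟨a + b, by simp [mul_add, ha, hb, blockSum, add_smul, Finset.sum_add_distrib]⟩
    | smul r x _ hx =>
      obtain ⟨a, ha⟩ := hx
      exact ⟨r • a, by simp [ha, blockSum, Finset.smul_sum, smul_smul]⟩
  have hTblock : ∀ a : Matrix (c.L l) (c.Rt l) k, blockSum T a ∈ c.cellSpan U := fun a =>
    sum_mem fun s _ => sum_mem fun t _ => Submodule.smul_mem _ _ (hTU s t)
  -- symmetry of the trace form interchanges the two annihilators
  have hann : ∀ x ∈ c.cellSpan U, f * x = x →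
      (∀ p q, x * T p q = 0) → ∀ p q, T p q * x = 0 := by
    intro x hx hfx h p q
    refine hnd _ fun b => ?_
    rw [mul_assoc, htr]
    obtain ⟨a, ha⟩ := hTspan (b * T p q) (c.mul_mem_cellSpan_left hU b (hTU p q))
    -- Cyclicity has moved `T p q` behind `b`. As `f` fixes `x`, the product `b * T p q` may be
    -- replaced by a combination of the `T`s, all killed by `x`.
    have : x * b * T p q = x * (f * (b * T p q)) := by
      rw [← mul_assoc x f, ← hfcomm, hfx, mul_assoc]
    rw [this, ha]
    simp [blockSum, Finset.mul_sum, h]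
  have hann' : ∀ x ∈ c.cellSpan U, f * x = x →
      (∀ p q, T p q * x = 0) → ∀ p q, x * T p q = 0 := by
    intro x hx hfx h p q
    refine hnd _ fun b => ?_
    rw [mul_assoc, htr]
    obtain ⟨a, ha⟩ := hTspan (T p q * b) (c.mul_mem_cellSpan_right hU b (hTU p q))
    have h3 : T p q * b * x = f * (T p q * b) * x := by
      rw [hfcomm, mul_assoc _ f, hfx]
    rw [h3, ha]
    simp [blockSum, Finset.sum_mul, h]
  obtain ⟨t₀, s₀, h₀⟩ := c.exists_basisBracket_ne_zero hlc
  -- A kernel vector `w` gives an element `x` with `x * T = 0`, hence `T * x = 0`. But `T s₀ t₀ * x`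
  -- has coefficients `w t * Φ t₀ s₀` with `Φ t₀ s₀ ≠ 0`.
  have hr : ∀ w : c.Rt l → k, (∀ p, ∑ t, w t * Φ t p = 0) → w = 0 := by
    intro w hw
    have h := hann (∑ t, w t • T s₀ t)
      (sum_mem fun t _ => Submodule.smul_mem _ _ (hTU s₀ t))
      (by simp only [Finset.mul_sum, mul_smul_comm, hfT])
      (fun p q => by
        simp only [Finset.sum_mul, smul_mul_assoc, hTmul, smul_smul, ← Finset.sum_smul, hw,
          zero_smul]) s₀ t₀
    simp only [Finset.mul_sum, mul_smul_comm, hTmul, smul_smul] at h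
    have h1 := hTlin (fun s t => if s = s₀ then w t * Φ t₀ s₀ else 0) (by
      simpa [blockSum, ite_smul] using h)
    funext t
    have h2 := congrFun (congrFun h1 s₀) t
    simp only [if_true, Matrix.zero_apply] at h2
    exact (mul_eq_zero.mp h2).resolve_right h₀
  have hl' : ∀ v : c.L l → k, (∀ q, ∑ s, Φ q s * v s = 0) → v = 0 := by
    intro v hv
    have h := hann' (∑ s, v s • T s t₀)
      (sum_mem fun s _ => Submodule.smul_mem _ _ (hTU s t₀))
      (by simp only [Finset.mul_sum, mul_smul_comm, hfT])
      (fun p q => by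
        simp only [Finset.mul_sum, mul_smul_comm, hTmul, smul_smul, ← Finset.sum_smul]
        rw [show ∑ s, v s * Φ q s = 0 by simpa only [mul_comm] using hv q, zero_smul]) s₀ t₀
    simp only [Finset.sum_mul, smul_mul_assoc, hTmul, smul_smul] at h
    have h1 := hTlin (fun s t => if t = t₀ then v s * Φ t₀ s₀ else 0) (by
      simpa [blockSum, ite_smul] using h)
    funext s
    have h2 := congrFun (congrFun h1 s) t₀
    simp only [if_true, Matrix.zero_apply] at h2
    exact (mul_eq_zero.mp h2).resolve_right h₀
  obtain ⟨Ψ, h₁, h₂⟩ := exists_two_sided_inverse Φ hr hl'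
  have hfΨ : f * blockSum T Ψ = blockSum T Ψ := by
    simp only [blockSum, Finset.mul_sum, mul_smul_comm, hfT]
  have hΨl : ∀ a : Matrix (c.L l) (c.Rt l) k, blockSum T Ψ * blockSum T a = blockSum T a := by
    intro a
    conv_lhs => rw [blockSum.eq_def T a]
    simp only [Finset.mul_sum, mul_smul_comm, blockSum_mul_of_inverse T Φ hTmul Ψ h₂]
    rfl
  have hΨr : ∀ a : Matrix (c.L l) (c.Rt l) k, blockSum T a * blockSum T Ψ = blockSum T a := by
    intro a
    conv_lhs => rw [blockSum.eq_def T a]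
    simp only [Finset.sum_mul, smul_mul_assoc, mul_blockSum_of_inverse T Φ hTmul Ψ h₁]
    rfl
  refine ⟨e + blockSum T Ψ, add_mem (hle he) (hTblock Ψ), fun x hx => ?_, fun x hx hnil => ?_⟩
  · obtain ⟨a, ha⟩ := hTspan x hx
    have h1 : blockSum T Ψ * x = f * x := by
      rw [← hfΨ, hfcomm, mul_assoc, ha, hΨl]
    have h2 : x * blockSum T Ψ = f * x := by
      rw [← hfΨ, ← mul_assoc, ← hfcomm, ha, hΨr]
    exact ⟨by rw [add_mul, h1, ← hsplit], by rw [mul_add, h2, ← hcomm, ← hsplit]⟩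
  · have hex : e * x = 0 := henil _ (heU' x) fun a b => by
      have := hnil (a * e) b
      rwa [mul_assoc a e x] at this
    obtain ⟨a, ha⟩ := hTspan x hx
    have hxa : x = blockSum T a := by rw [← ha]; conv_lhs => rw [hsplit x, hex, zero_add]
    have := blockSum_eq_zero_of_isNilpotent T Φ hTmul hTne Ψ h₁ h₂ a (by rwa [← hxa])
    rw [hxa, this]
    simp [blockSum]

/-- In a symmetric cell algebra with nonzero brackets, each ideal spanned by an upper set of cells
is unital and contains no nonzero element generating a nil ideal. -/
theorem isUnitalNonNil_of_isUpperSet (tr : A →ₗ[k] k) (htr : ∀ a b, tr (a * b) = tr (b * a))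
    (hnd : ∀ a, (∀ b, tr (a * b) = 0) → a = 0) (hc : c.Λ₀ = Set.univ) (U : Set c.Λ)
    (hU : IsUpperSet U) : c.IsUnitalNonNil U := by
  induction hn : U.ncard using Nat.strong_induction_on generalizing U with
  | _ n ih =>
  rcases U.eq_empty_or_nonempty with rfl | hne
  · refine ⟨0, zero_mem _, ?_, ?_⟩ <;> intro x hx <;> simp_all [cellSpan]
  -- Minimality of `l` is what keeps `U \ {l}` an upper set.
  obtain ⟨l, hl⟩ := (Set.toFinite U).exists_minimal hne
  have hlU : l ∈ U := hl.1
  have hU' : IsUpperSet (U \ {l}) := by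
    rintro a b hab ⟨ha, hal⟩
    refine ⟨hU hab ha, ?_⟩
    rintro rfl
    exact hal (le_antisymm hab (hl.2 ha hab))
  exact IsUnitalNonNil.of_diff_singleton c tr htr hnd U (U \ {l}) l (hc ▸ Set.mem_univ l) hlU hU
    hU' rfl (ih _ (by
      rw [← hn]; exact Set.ncard_sdiff_singleton_lt_of_mem hlU (Set.toFinite U)) _ hU' rfl)

end CellStructure

/-- If the group algebra of a finite group is a cell algebra with nonzero brackets, then the order
of the group is invertible. -/
theorem card_ne_zero_of_isFullCellAlgebra (k G : Type*) [Field k] [Group G] [Finite G]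
    (h : IsFullCellAlgebra k (MonoidAlgebra k G)) : (Nat.card G : k) ≠ 0 := by
  classical
  have := Fintype.ofFinite G
  obtain ⟨c, hc⟩ := h
  let tr : MonoidAlgebra k G →ₗ[k] k :=
    { toFun := fun x => x.coeff 1, map_add' := fun _ _ => rfl, map_smul' := fun _ _ => rfl }
  have htr_apply : ∀ x, tr x = x.coeff 1 := fun _ => rfl
  have htr : ∀ a b, tr (a * b) = tr (b * a) := by
    intro a b
    induction a using MonoidAlgebra.induction_linear with
    | zero => simp
    | add x y hx hy => rw [add_mul, mul_add, map_add, map_add, hx, hy]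
    | single g r =>
      induction b using MonoidAlgebra.induction_linear with
      | zero => simp
      | add x y hx hy => rw [add_mul, mul_add, map_add, map_add, hx, hy]
      | single g' r' =>
        have h1 : g * g' = 1 ↔ g' * g = 1 := by
          rw [mul_eq_one_iff_eq_inv, mul_eq_one_iff_inv_eq, eq_comm]
        simp only [htr_apply, MonoidAlgebra.single_mul_single, MonoidAlgebra.coeff_single,
          Finsupp.single_apply, mul_comm r, h1]
  have hnd : ∀ a, (∀ b, tr (a * b) = 0) → a = 0 := by
    intro a ha
    ext g
    have := ha (MonoidAlgebra.single g⁻¹ 1)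
    rw [htr_apply] at this
    simpa [MonoidAlgebra.coeff_mul_single_eq_coeff_mul g (x := a) (m := g⁻¹) (m₁ := 1)
      (fun m _ => by rw [mul_inv_eq_one])] using this
  obtain ⟨-, -, -, hnil⟩ := c.isUnitalNonNil_of_isUpperSet tr htr hnd hc Set.univ isUpperSet_univ
  have htop : c.cellSpan Set.univ = ⊤ := by
    rw [eq_top_iff, ← c.C.span_eq]
    refine Submodule.span_mono ?_
    rintro _ ⟨⟨m, p, q⟩, rfl⟩
    exact ⟨m, trivial, p, q, rfl⟩
  intro h0
  set σ : MonoidAlgebra k G := ∑ g : G, MonoidAlgebra.single g 1 with hσ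
  have hl : ∀ a : MonoidAlgebra k G, ∃ r : k, a * σ = r • σ := by
    intro a
    induction a using MonoidAlgebra.induction_linear with
    | zero => exact ⟨0, by simp⟩
    | add x y hx hy =>
      obtain ⟨r, hr⟩ := hx
      obtain ⟨s, hs⟩ := hy
      exact ⟨r + s, by rw [add_mul, hr, hs, add_smul]⟩
    | single g r =>
      refine ⟨r, ?_⟩
      simp only [hσ, Finset.mul_sum, MonoidAlgebra.single_mul_single, Finset.smul_sum,
        MonoidAlgebra.smul_single, smul_eq_mul]
      exact Fintype.sum_equiv (Equiv.mulLeft g) _ _ fun _ => rfl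
  have hσg : ∀ g : G, MonoidAlgebra.single g 1 * σ = σ := by
    intro g
    simp only [hσ, Finset.mul_sum, MonoidAlgebra.single_mul_single, mul_one]
    exact Fintype.sum_equiv (Equiv.mulLeft g) _ _ fun _ => rfl
  have hsq : σ * σ = 0 := by
    conv_lhs => enter [1]; rw [hσ]
    rw [Finset.sum_mul]
    simp only [hσg, Finset.sum_const, Finset.card_univ]
    rw [← Nat.card_eq_fintype_card, ← Nat.cast_smul_eq_nsmul k, h0, zero_smul]
  -- Every `a * σ * b` squares to zero: left multiples of `σ` are scalar multiples of `σ`, so a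
  -- factor `σ * σ = 0` appears.
  have hz : σ = 0 := hnil σ (htop ▸ Submodule.mem_top) fun a b => by
    obtain ⟨r, hr⟩ := hl a
    obtain ⟨s, hs⟩ := hl b
    obtain ⟨u, hu⟩ := hl (b * a)
    refine ⟨2, ?_⟩
    rw [pow_two, hr]
    have : r • σ * b * (r • σ * b) = (r * r) • (σ * (b * σ) * b) := by
      simp only [smul_mul_assoc, mul_smul_comm, smul_smul, mul_assoc]
    rw [this, hs, mul_smul_comm, hsq]
    simp
  have := congrArg (fun x => x.coeff 1) hz
  simp [hσ, MonoidAlgebra.coeff_sum, Finsupp.single_apply] at this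

end MonoidCell

namespace MonoidCell

/-! ### Green's relations in a finite monoid -/

section Green

variable {M : Type*} [Monoid M]

theorem greenL_iff {x y : M} : GreenL x y ↔ (∃ c, x = c * y) ∧ ∃ d, y = d * x := by
  constructor
  · intro h
    unfold GreenL at h
    have hx : x ∈ Set.range (fun m : M => m * x) := ⟨1, one_mul x⟩
    have hy : y ∈ Set.range (fun m : M => m * y) := ⟨1, one_mul y⟩
    rw [h] at hx
    rw [← h] at hy
    obtain ⟨c, hc⟩ := hx
    obtain ⟨d, hd⟩ := hy
    exact ⟨⟨c, hc.symm⟩, d, hd.symm⟩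
  · rintro ⟨⟨c, hc⟩, d, hd⟩
    apply Set.Subset.antisymm
    · rintro _ ⟨m, rfl⟩
      exact ⟨m * c, by simp only [mul_assoc, ← hc]⟩
    · rintro _ ⟨m, rfl⟩
      exact ⟨m * d, by simp only [mul_assoc, ← hd]⟩

theorem greenR_iff {x y : M} : GreenR x y ↔ (∃ c, x = y * c) ∧ ∃ d, y = x * d := by
  constructor
  · intro h
    unfold GreenR at h
    have hx : x ∈ Set.range (fun m : M => x * m) := ⟨1, mul_one x⟩
    have hy : y ∈ Set.range (fun m : M => y * m) := ⟨1, mul_one y⟩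
    rw [h] at hx
    rw [← h] at hy
    obtain ⟨c, hc⟩ := hx
    obtain ⟨d, hd⟩ := hy
    exact ⟨⟨c, hc.symm⟩, d, hd.symm⟩
  · rintro ⟨⟨c, hc⟩, d, hd⟩
    apply Set.Subset.antisymm
    · rintro _ ⟨m, rfl⟩
      exact ⟨c * m, by simp only [← mul_assoc, ← hc]⟩
    · rintro _ ⟨m, rfl⟩
      exact ⟨d * m, by simp only [← mul_assoc, ← hd]⟩

theorem GreenL.symm {x y : M} (h : GreenL x y) : GreenL y x := Eq.symm h
theorem GreenR.symm {x y : M} (h : GreenR x y) : GreenR y x := Eq.symm h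
theorem GreenL.trans {x y z : M} (h : GreenL x y) (h' : GreenL y z) : GreenL x z := Eq.trans h h'
theorem GreenR.trans {x y z : M} (h : GreenR x y) (h' : GreenR y z) : GreenR x z := Eq.trans h h'

theorem GreenL.mul_right {x y : M} (h : GreenL x y) (a : M) : GreenL (x * a) (y * a) := by
  obtain ⟨⟨c, hc⟩, d, hd⟩ := greenL_iff.mp h
  exact greenL_iff.mpr ⟨⟨c, by rw [← mul_assoc, ← hc]⟩, d, by rw [← mul_assoc, ← hd]⟩

theorem GreenR.mul_left {x y : M} (h : GreenR x y) (a : M) : GreenR (a * x) (a * y) := by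
  obtain ⟨⟨c, hc⟩, d, hd⟩ := greenR_iff.mp h
  exact greenR_iff.mpr ⟨⟨c, by rw [mul_assoc, ← hc]⟩, d, by rw [mul_assoc, ← hd]⟩

/-- `x ∈ M y M`. -/
def JLe (x y : M) : Prop := ∃ a b : M, x = a * y * b

theorem JLe.refl (x : M) : JLe x x := ⟨1, 1, by simp⟩

theorem JLe.trans {x y z : M} (h : JLe x y) (h' : JLe y z) : JLe x z := by
  obtain ⟨a, b, rfl⟩ := h
  obtain ⟨c, d, rfl⟩ := h'
  exact ⟨a * c, d * b, by simp only [mul_assoc]⟩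

theorem jLe_mul_left (a x : M) : JLe (a * x) x := ⟨a, 1, by simp⟩

theorem jLe_mul_right (x a : M) : JLe (x * a) x := ⟨1, a, by simp⟩

theorem GreenL.jLe {x y : M} (h : GreenL x y) : JLe x y := by
  obtain ⟨⟨c, rfl⟩, -⟩ := greenL_iff.mp h
  exact jLe_mul_left _ _

theorem GreenR.jLe {x y : M} (h : GreenR x y) : JLe x y := by
  obtain ⟨⟨c, rfl⟩, -⟩ := greenR_iff.mp h
  exact jLe_mul_right _ _

theorem GreenD.jLe {x y : M} (h : GreenD x y) : JLe x y :=
  let ⟨_, h₁, h₂⟩ := h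
  h₁.jLe.trans h₂.jLe

theorem GreenD.jLe' {x y : M} (h : GreenD x y) : JLe y x :=
  let ⟨_, h₁, h₂⟩ := h
  h₂.symm.jLe.trans h₁.symm.jLe

variable [Finite M]

/-- Left stability of a finite monoid. -/
theorem greenL_of_jLe_mul {a x : M} (h : JLe x (a * x)) : GreenL (a * x) x := by
  obtain ⟨c, d, hcd⟩ := h
  refine Set.eq_of_subset_of_ncard_le ?_ ?_ (Set.toFinite _)
  · rintro _ ⟨m, rfl⟩
    exact ⟨m * a, by simp only [mul_assoc]⟩
  -- From `x = c * (a * x) * d`, the set `M x` lies in the right translate by `d` of `M a x`, so it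
  -- cannot be the larger of the two.
  · calc (Set.range fun m : M => m * x).ncard
        ≤ ((fun y => y * d) '' Set.range fun m : M => m * (a * x)).ncard := by
          refine Set.ncard_le_ncard ?_ (Set.toFinite _)
          rintro _ ⟨m, rfl⟩
          refine ⟨_, ⟨m * c, rfl⟩, ?_⟩
          conv_rhs => rw [hcd]
          simp only [mul_assoc]
      _ ≤ _ := Set.ncard_image_le (Set.toFinite _)

/-- Right stability of a finite monoid. -/
theorem greenR_of_jLe_mul {a x : M} (h : JLe x (x * a)) : GreenR (x * a) x := by
  obtain ⟨c, d, hcd⟩ := h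
  refine Set.eq_of_subset_of_ncard_le ?_ ?_ (Set.toFinite _)
  · rintro _ ⟨m, rfl⟩
    exact ⟨a * m, by simp only [mul_assoc]⟩
  · calc (Set.range fun m : M => x * m).ncard
        ≤ ((fun y => c * y) '' Set.range fun m : M => x * a * m).ncard := by
          refine Set.ncard_le_ncard ?_ (Set.toFinite _)
          rintro _ ⟨m, rfl⟩
          refine ⟨_, ⟨d * m, rfl⟩, ?_⟩
          conv_rhs => rw [hcd]
          simp only [mul_assoc]
      _ ≤ _ := Set.ncard_image_le (Set.toFinite _)

/-- Green's lemma: left translation by `d` carries the `𝓗`-class of `x` into that of `z`, and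
translation by `c` undoes it. -/
theorem card_hClass_le_of_greenL {x z : M} (h : GreenL x z) :
    Nat.card (hClass x) ≤ Nat.card (hClass z) := by
  obtain ⟨⟨c, hc⟩, d, hd⟩ := greenL_iff.mp h
  have hdc : ∀ y ∈ hClass x, c * (d * y) = y := by
    rintro y ⟨-, hy⟩
    obtain ⟨⟨b, rfl⟩, -⟩ := greenR_iff.mp hy.symm
    rw [← mul_assoc d, ← hd, ← mul_assoc, ← hc]
  refine Nat.card_le_card_of_injective (fun y : hClass x => (⟨d * y.1, ?_, ?_⟩ : hClass z)) ?_
  · refine h.symm.trans (y.2.1.trans (greenL_iff.mpr ⟨⟨c, (hdc y y.2).symm⟩, d, rfl⟩))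
  · have := y.2.2.mul_left d
    rwa [← hd] at this
  · intro y y' hyy'
    have : d * y.1 = d * y'.1 := congrArg Subtype.val hyy'
    exact Subtype.ext (by rw [← hdc y y.2, this, hdc y' y'.2])

theorem card_hClass_le_of_greenR {x z : M} (h : GreenR x z) :
    Nat.card (hClass x) ≤ Nat.card (hClass z) := by
  obtain ⟨⟨c, hc⟩, d, hd⟩ := greenR_iff.mp h
  have hdc : ∀ y ∈ hClass x, y * d * c = y := by
    rintro y ⟨hy, -⟩
    obtain ⟨⟨b, rfl⟩, -⟩ := greenL_iff.mp hy.symm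
    rw [mul_assoc b, ← hd, mul_assoc, ← hc]
  refine Nat.card_le_card_of_injective (fun y : hClass x => (⟨y.1 * d, ?_, ?_⟩ : hClass z)) ?_
  · have := y.2.1.mul_right d
    rwa [← hd] at this
  · refine h.symm.trans (y.2.2.trans (greenR_iff.mpr ⟨⟨c, (hdc y y.2).symm⟩, d, rfl⟩))
  · intro y y' hyy'
    have : y.1 * d = y'.1 * d := congrArg Subtype.val hyy'
    exact Subtype.ext (by rw [← hdc y y.2, this, hdc y' y'.2])

theorem card_hClass_eq_of_greenD {x y : M} (h : GreenD x y) :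
    Nat.card (hClass x) = Nat.card (hClass y) := by
  obtain ⟨z, h₁, h₂⟩ := h
  exact le_antisymm ((card_hClass_le_of_greenL h₁).trans (card_hClass_le_of_greenR h₂))
    ((card_hClass_le_of_greenR h₂.symm).trans (card_hClass_le_of_greenL h₁.symm))

end Green

/-! ### The order of the Schützenberger group -/

section Schutzenberger

variable {M : Type*} [Monoid M]

theorem self_mem_hClass (γ : M) : γ ∈ hClass γ := ⟨rfl, rfl⟩

/-- The orbit map `g ↦ γ g` of the Schützenberger group. -/
def SchutzenbergerGroup.orbit (γ : M) (g : SchutzenbergerGroup γ) : hClass γ :=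
  (MulOpposite.unop g.1 : hClass γ → hClass γ) ⟨γ, self_mem_hClass γ⟩

theorem SchutzenbergerGroup.exists_rep {γ : M} (g : SchutzenbergerGroup γ) :
    ∃ m ∈ RT (hClass γ), ∀ h : hClass γ,
      ((MulOpposite.unop g.1 : hClass γ → hClass γ) h).1 = h.1 * m := by
  obtain ⟨_, ⟨m, rfl⟩⟩ := g
  exact ⟨m.1, m.2, fun h => rfl⟩

/-- The action on the `𝓗`-class is simply transitive. Its elements have the form `c * γ`, so a right
translation is determined by its value at `γ`, and any `m` keeping `γ` in the class preserves the
whole class. -/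
theorem SchutzenbergerGroup.orbit_bijective (γ : M) :
    Function.Bijective (SchutzenbergerGroup.orbit γ) := by
  constructor
  · intro g g' h
    obtain ⟨m, -, hm⟩ := g.exists_rep
    obtain ⟨m', -, hm'⟩ := g'.exists_rep
    refine Subtype.ext (MulOpposite.unop_injective (funext fun x => Subtype.ext ?_))
    have h' : γ * m = γ * m' := by
      rw [← hm ⟨γ, self_mem_hClass γ⟩, ← hm' ⟨γ, self_mem_hClass γ⟩]
      exact congrArg Subtype.val h
    obtain ⟨-, c, hc⟩ := greenL_iff.mp x.2.1
    refine (hm x).trans (Eq.trans ?_ (hm' x).symm)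
    rw [hc, mul_assoc, h', mul_assoc]
  · rintro ⟨h, hL, hR⟩
    obtain ⟨⟨t, ht⟩, m, rfl⟩ := greenR_iff.mp hR
    have hm : m ∈ RT (hClass γ) := by
      rintro x ⟨hx, hx'⟩
      obtain ⟨-, c, rfl⟩ := greenL_iff.mp hx
      refine ⟨hL.trans (hx.mul_right m), hx'.trans (greenR_iff.mpr ⟨⟨t, ?_⟩, m, rfl⟩)⟩
      rw [mul_assoc c, mul_assoc c, ← ht]
    exact ⟨⟨_, ⟨⟨m, hm⟩, rfl⟩⟩, rfl⟩

theorem card_schutzenbergerGroup (γ : M) :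
    Nat.card (SchutzenbergerGroup γ) = Nat.card (hClass γ) :=
  Nat.card_congr (Equiv.ofBijective _ (SchutzenbergerGroup.orbit_bijective γ))

instance [Finite M] (γ : M) : Finite (SchutzenbergerGroup γ) :=
  Finite.of_injective _ (SchutzenbergerGroup.orbit_bijective γ).1

theorem SchutzenbergerGroup.orbit_one (γ : M) : (orbit γ 1).1 = γ := rfl

/-- An idempotent `e` is a right identity on its `𝓛`-class, so the group is realised inside `M` as
the `𝓗`-class of `e`. -/
theorem SchutzenbergerGroup.orbit_mul {e : M} (he : e * e = e) (g g' : SchutzenbergerGroup e) :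
    (orbit e (g * g')).1 = (orbit e g).1 * (orbit e g').1 := by
  obtain ⟨m', -, hm'⟩ := g'.exists_rep
  have h1 : (orbit e (g * g')).1 = (orbit e g).1 * m' := hm' (orbit e g)
  have h2 : (orbit e g').1 = e * m' := hm' ⟨e, self_mem_hClass e⟩
  obtain ⟨-, c, hc⟩ := greenL_iff.mp (orbit e g).2.1
  rw [h1, h2, ← mul_assoc]
  congr 1
  rw [hc, mul_assoc, he]

end Schutzenberger

/-! ### Idempotents in `𝓓`-classes -/

section Idempotent

variable {M : Type*} [Monoid M]

theorem greenD_refl (x : M) : GreenD x x := ⟨x, rfl, rfl⟩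

theorem exists_idempotent_of_regular {x y : M} (h : x = x * y * x) :
    ∃ e : M, e * e = e ∧ JLe e x ∧ JLe x e :=
  ⟨x * y, by rw [← mul_assoc, ← h], jLe_mul_right _ _, by
    conv_lhs => rw [h]
    exact jLe_mul_right _ _⟩

/-- A product `x * y` of elements of `D` outside `Â^D` must stay in `D`. Stability then gives `x = x
* y * z` and `y = t * (x * y)`, whence `x = x * t * x` is regular. -/
theorem exists_idempotent_of_not_sqSubsetHat [Finite M] (k : Type*) [Field k]
    (h : ∀ D : DClass M, ¬ SqSubsetHat k D) (m : M) :
    ∃ e : M, e * e = e ∧ JLe e m ∧ JLe m e := by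
  have hD := h ⟨dClass m, m, rfl⟩
  unfold SqSubsetHat at hD
  rw [Set.not_subset] at hD
  obtain ⟨_, ⟨_, ⟨x, hx, y, hy, rfl⟩, rfl⟩, hxy⟩ := hD
  have hD' : (⟨dClass (x * y), x * y, rfl⟩ : DClass M) = ⟨dClass m, m, rfl⟩ := by
    by_contra hne
    refine hxy (Submodule.subset_span ⟨⟨dClass (x * y), x * y, rfl⟩, ⟨?_, hne⟩, x * y,
      greenD_refl _, rfl⟩)
    exact ⟨x * y, greenD_refl _, x, hx, 1, y, by simp⟩
  have hcar : dClass (x * y) = dClass m := congrArg Subtype.val hD'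
  have hx' : GreenD (x * y) x := by
    change x ∈ dClass (x * y)
    rw [hcar]
    exact hx
  have hy' : GreenD (x * y) y := by
    change y ∈ dClass (x * y)
    rw [hcar]
    exact hy
  obtain ⟨-, z, hz⟩ := greenR_iff.mp (greenR_of_jLe_mul hx'.jLe')
  obtain ⟨-, t, ht⟩ := greenL_iff.mp (greenL_of_jLe_mul hy'.jLe')
  have hreg : x = x * t * x := by
    calc x = x * y * z := hz
      _ = x * (t * (x * y)) * z := by rw [← ht]
      _ = x * t * (x * y * z) := by simp only [mul_assoc]
      _ = x * t * x := by rw [← hz]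
  obtain ⟨e, he, h₁, h₂⟩ := exists_idempotent_of_regular hreg
  exact ⟨e, he, h₁.trans (GreenD.jLe' (x := m) hx), (GreenD.jLe (y := x) hx).trans h₂⟩

end Idempotent

end MonoidCell

namespace MonoidCell

/-! ### Ideals of a monoid algebra spanned by ideals of the monoid -/

section SetIdeal

variable {M : Type*} [Monoid M]

/-- `S` is a two-sided ideal of the monoid. -/
def IsMonoidIdeal (S : Set M) : Prop := ∀ x ∈ S, ∀ a b : M, a * x * b ∈ S

theorem IsMonoidIdeal.mul_left {S : Set M} (hS : IsMonoidIdeal S) {x : M} (hx : x ∈ S) (a : M) :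
    a * x ∈ S := by simpa using hS x hx a 1

theorem IsMonoidIdeal.mul_right {S : Set M} (hS : IsMonoidIdeal S) {x : M} (hx : x ∈ S) (b : M) :
    x * b ∈ S := by simpa using hS x hx 1 b

theorem IsMonoidIdeal.of_jLe {S : Set M} (hS : IsMonoidIdeal S) {x y : M} (hx : x ∈ S)
    (h : JLe y x) : y ∈ S := by
  obtain ⟨a, b, rfl⟩ := h
  exact hS x hx a b

variable (k : Type*) [Field k]

/-- The left ideal of `k[M]` generated by a subset of `M`. -/
noncomputable def setIdeal (S : Set M) : Ideal (MonoidAlgebra k M) :=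
  Ideal.span ((fun m => MonoidAlgebra.single m 1) '' S)

variable {k}

theorem single_mem_setIdeal {S : Set M} {m : M} (hm : m ∈ S) (r : k) :
    MonoidAlgebra.single m r ∈ setIdeal k S := by
  have := Ideal.mul_mem_left (setIdeal k S) (MonoidAlgebra.single 1 r)
    (Ideal.subset_span ⟨m, hm, rfl⟩)
  simpa [MonoidAlgebra.single_mul_single] using this

theorem setIdeal_mono {S T : Set M} (h : S ⊆ T) : setIdeal k S ≤ setIdeal k T :=
  Ideal.span_mono (Set.image_mono h)

/-- Sums of monomials supported in a monoid ideal are already closed under left multiplication, so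
the generated left ideal is just the linear span of `S`. -/
theorem setIdeal_induction {S : Set M} (hS : IsMonoidIdeal S) {P : MonoidAlgebra k M → Prop}
    (zero : P 0) (add : ∀ x y, P x → P y → P (x + y))
    (single : ∀ m ∈ S, ∀ r, P (MonoidAlgebra.single m r)) {x : MonoidAlgebra k M}
    (hx : x ∈ setIdeal k S) : P x := by
  let N : AddSubmonoid (MonoidAlgebra k M) :=
    AddSubmonoid.closure {y | ∃ m ∈ S, ∃ r : k, y = MonoidAlgebra.single m r}
  have hmul : ∀ a, ∀ y ∈ N, a * y ∈ N := by
    intro a y hy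
    induction hy using AddSubmonoid.closure_induction with
    | mem y hy =>
      obtain ⟨m, hm, r, rfl⟩ := hy
      induction a using MonoidAlgebra.induction_linear with
      | zero => simp
      | add a b ha hb => rw [add_mul]; exact add_mem ha hb
      | single g s =>
        rw [MonoidAlgebra.single_mul_single]
        exact AddSubmonoid.subset_closure ⟨_, hS.mul_left hm g, _, rfl⟩
    | zero => simp
    | add x y _ _ hx hy => rw [mul_add]; exact add_mem hx hy
  have hN : x ∈ N := by
    unfold setIdeal at hx
    induction hx using Submodule.span_induction with
    | mem x hx =>
      obtain ⟨m, hm, rfl⟩ := hx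
      exact AddSubmonoid.subset_closure ⟨m, hm, 1, rfl⟩
    | zero => exact zero_mem _
    | add x y _ _ hx hy => exact add_mem hx hy
    | smul a x _ hx => exact hmul a x hx
  clear hx
  induction hN using AddSubmonoid.closure_induction with
  | mem x hx => obtain ⟨m, hm, r, rfl⟩ := hx; exact single m hm r
  | zero => exact zero
  | add x y _ _ hx hy => exact add x y hx hy

theorem coeff_eq_zero_of_mem_setIdeal {S : Set M} (hS : IsMonoidIdeal S) {x : MonoidAlgebra k M}
    (hx : x ∈ setIdeal k S) {m : M} (hm : m ∉ S) : x.coeff m = 0 := by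
  classical
  refine setIdeal_induction hS (P := fun x => x.coeff m = 0) (by simp) ?_ ?_ hx
  · intro x y hx hy; simp [hx, hy]
  · intro m' hm' r
    rw [MonoidAlgebra.coeff_single, Finsupp.single_apply, if_neg]
    rintro rfl
    exact hm hm'

theorem setIdeal_isTwoSided {S : Set M} (hS : IsMonoidIdeal S) : (setIdeal k S).IsTwoSided := by
  refine ⟨fun {a} b ha => ?_⟩
  refine setIdeal_induction hS (P := fun a => a * b ∈ setIdeal k S) (by simp) ?_ ?_ ha
  · intro x y hx hy; rw [add_mul]; exact add_mem hx hy
  · intro m hm r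
    induction b using MonoidAlgebra.induction_linear with
    | zero => simp
    | add a b ha hb => rw [mul_add]; exact add_mem ha hb
    | single g s =>
      rw [MonoidAlgebra.single_mul_single]
      exact single_mem_setIdeal (hS.mul_right hm g) _

theorem setIdeal_empty : setIdeal k (∅ : Set M) = ⊥ := by simp [setIdeal]

theorem setIdeal_univ : setIdeal k (Set.univ : Set M) = ⊤ :=
  (Ideal.eq_top_iff_one _).mpr (single_mem_setIdeal (Set.mem_univ 1) 1)

end SetIdeal

/-! ### Projectivity from a dual basis -/

/-- The `τ j` induce left-linear forms on `I / I'` for which the `v j` are a dual basis, so the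
identity factors through a free module. Linearity is needed only on `I` and modulo `I'`, so the `τ
j` may be merely additive on `A`. -/
theorem projective_map_mk_of_dualBasis {A ι : Type*} [Ring A] [Fintype ι] (I' I : Ideal A)
    [I'.IsTwoSided] (τ : ι → A →+ A) (v : ι → A) (hv : ∀ j, v j ∈ I)
    (h₁ : ∀ j, ∀ x ∈ I', τ j x ∈ I') (h₂ : ∀ j a, ∀ x ∈ I, τ j (a * x) - a * τ j x ∈ I')
    (h₃ : ∀ x ∈ I, x - ∑ j, τ j x * v j ∈ I') :
    Module.Projective (A ⧸ I') (I.map (Ideal.Quotient.mk I')) := by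
  let q := Ideal.Quotient.mk I'
  have hq : Function.Surjective q := Ideal.Quotient.mk_surjective
  let σ : ι → (A ⧸ I') →+ (A ⧸ I') := fun j =>
    QuotientAddGroup.lift I'.toAddSubgroup (q.toAddMonoidHom.comp (τ j)) (fun x hx =>
      Ideal.Quotient.eq_zero_iff_mem.mpr (h₁ j x hx))
  have hσ : ∀ j x, σ j (q x) = q (τ j x) := fun j x => rfl
  let i : (I.map q) →ₗ[A ⧸ I'] (ι → A ⧸ I') :=
    { toFun := fun x j => σ j x.1
      map_add' := fun x y => by funext j; simp
      map_smul' := fun b x => by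
        funext j
        obtain ⟨a, rfl⟩ := hq b
        obtain ⟨_, hx⟩ := x
        obtain ⟨y, hy, rfl⟩ := (Ideal.mem_map_iff_of_surjective q hq).mp hx
        have := Ideal.Quotient.eq_zero_iff_mem.mpr (h₂ j a y hy)
        rw [map_sub, sub_eq_zero] at this
        exact this }
  let s : (ι → A ⧸ I') →ₗ[A ⧸ I'] (I.map q) :=
    ∑ j, (LinearMap.toSpanSingleton (A ⧸ I') (I.map q) ⟨q (v j), Ideal.mem_map_of_mem q (hv j)⟩).comp
      (LinearMap.proj j)
  refine Module.Projective.of_split i s (LinearMap.ext fun x => Subtype.ext ?_)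
  obtain ⟨_, hx⟩ := x
  obtain ⟨y, hy, rfl⟩ := (Ideal.mem_map_iff_of_surjective q hq).mp hx
  have := Ideal.Quotient.eq_zero_iff_mem.mpr (h₃ y hy)
  rw [map_sub, sub_eq_zero, map_sum] at this
  simp only [map_mul] at this
  simp only [s, i, LinearMap.comp_apply, LinearMap.sum_apply, LinearMap.id_apply,
    LinearMap.coe_mk, AddHom.coe_mk, LinearMap.proj_apply, LinearMap.toSpanSingleton_apply,
    AddSubmonoidClass.coe_finsetSum, Submodule.coe_smul, hσ, smul_eq_mul]
  exact this.symm

/-! ### The layer of an idempotent -/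

section Layer

variable {M : Type*} [Monoid M] {S S' : Set M} {e : M}

variable (S S' e) in
/-- `S'` and `S` are monoid ideals and `S \ S'` is the `𝓙`-class of the idempotent `e`. -/
structure IsRegularLayer : Prop where
  ideal : IsMonoidIdeal S
  ideal' : IsMonoidIdeal S'
  subset : S' ⊆ S
  idem : e * e = e
  mem : e ∈ S
  notMem : e ∉ S'
  jLe : ∀ x ∈ S, x ∉ S' → JLe x e ∧ JLe e x

theorem IsRegularLayer.notMem_of_jLe (h : IsRegularLayer S S' e) {x : M} (hx : JLe e x) :
    x ∉ S' := fun hx' =>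
  h.notMem (h.ideal'.of_jLe hx' hx)

variable {k : Type*} [Field k]

/-- By stability each `e * m * e` lies either in `S'` or in the `𝓗`-class of `e`. With
`eq_zero_of_mapDomain_mem` this identifies the corner at `e`, modulo `S'`, with the group algebra.
-/
theorem IsRegularLayer.exists_compress [Finite M] (h : IsRegularLayer S S' e)
    (x : MonoidAlgebra k M) :
    ∃ y : MonoidAlgebra k (SchutzenbergerGroup e),
      MonoidAlgebra.single e 1 * x * MonoidAlgebra.single e 1 -
        MonoidAlgebra.mapDomain (fun g => (SchutzenbergerGroup.orbit e g).1) y ∈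
          setIdeal k S' := by
  induction x using MonoidAlgebra.induction_linear with
  | zero => exact ⟨0, by simp⟩
  | add x x' hx hx' =>
    obtain ⟨y, hy⟩ := hx
    obtain ⟨y', hy'⟩ := hx'
    refine ⟨y + y', ?_⟩
    rw [MonoidAlgebra.mapDomain_add, mul_add, add_mul, add_sub_add_comm]
    exact add_mem hy hy'
  | single m r =>
    simp only [MonoidAlgebra.single_mul_single, one_mul, mul_one]
    by_cases hm : e * m * e ∈ S'
    · exact ⟨0, by simpa using single_mem_setIdeal hm r⟩
    · have hS : e * m * e ∈ S := h.ideal.mul_left h.mem _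
      have hJ := (h.jLe _ hS hm).2
      have hL : GreenL e (e * m * e) := (greenL_of_jLe_mul hJ).symm
      have hR : GreenR e (e * m * e) := by
        rw [mul_assoc] at hJ ⊢
        exact (greenR_of_jLe_mul hJ).symm
      obtain ⟨g, hg⟩ := (SchutzenbergerGroup.orbit_bijective e).2 ⟨e * m * e, hL, hR⟩
      refine ⟨MonoidAlgebra.single g r, ?_⟩
      rw [MonoidAlgebra.mapDomain_single, hg, sub_self]
      exact zero_mem _

theorem IsRegularLayer.eq_zero_of_mapDomain_mem (h : IsRegularLayer S S' e)
    {y : MonoidAlgebra k (SchutzenbergerGroup e)}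
    (hy : MonoidAlgebra.mapDomain (fun g => (SchutzenbergerGroup.orbit e g).1) y ∈
      setIdeal k S') : y = 0 := by
  have hinj : Function.Injective (fun g => (SchutzenbergerGroup.orbit e g).1) :=
    Subtype.val_injective.comp (SchutzenbergerGroup.orbit_bijective e).1
  ext g
  have h1 := coeff_eq_zero_of_mem_setIdeal h.ideal' hy
    (m := (SchutzenbergerGroup.orbit e g).1)
    (h.notMem_of_jLe (SchutzenbergerGroup.orbit e g).2.1.jLe)
  rw [MonoidAlgebra.mapDomain, MonoidAlgebra.coeff_ofCoeff,
    Finsupp.mapDomain_apply hinj] at h1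
  simpa using h1

end Layer

end MonoidCell

namespace MonoidCell

/-! ### The heredity axioms for a regular layer -/

section Layer

variable {M : Type*} [Monoid M] {S S' : Set M} {e : M} {k : Type*} [Field k]

/-- `e rad(B) e` lies in the radical of the corner `eBe`, a copy of `k[G_e]`, which Maschke's
theorem makes semisimple. -/
theorem IsRegularLayer.compress_jacobson [Finite M] (h : IsRegularLayer S S' e)
    (hcard : (Nat.card (SchutzenbergerGroup e) : k) ≠ 0) [(setIdeal k S').IsTwoSided]
    {r : MonoidAlgebra k M ⧸ setIdeal k S'}
    (hr : r ∈ Ring.jacobson (MonoidAlgebra k M ⧸ setIdeal k S')) :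
    Ideal.Quotient.mk (setIdeal k S') (MonoidAlgebra.single e 1) * r *
      Ideal.Quotient.mk (setIdeal k S') (MonoidAlgebra.single e 1) = 0 := by
  have : NeZero (Nat.card (SchutzenbergerGroup e) : k) := ⟨hcard⟩
  have hss : IsSemisimpleRing (MonoidAlgebra k (SchutzenbergerGroup e)) := inferInstance
  let q := Ideal.Quotient.mk (setIdeal k S')
  let f : SchutzenbergerGroup e →ₙ* M :=
    ⟨fun g => (SchutzenbergerGroup.orbit e g).1, SchutzenbergerGroup.orbit_mul h.idem⟩
  let φ : MonoidAlgebra k (SchutzenbergerGroup e) →ₙ+* MonoidAlgebra k M :=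
    MonoidAlgebra.mapDomainNonUnitalRingHom k f
  have hφ : ∀ y, φ y = MonoidAlgebra.mapDomain (fun g => (SchutzenbergerGroup.orbit e g).1) y :=
    fun _ => rfl
  have hφ1 : φ 1 = MonoidAlgebra.single e 1 := by
    rw [hφ, MonoidAlgebra.one_def, MonoidAlgebra.mapDomain_single, SchutzenbergerGroup.orbit_one]
  have hcomp : ∀ b, ∃ y, q (φ 1) * b * q (φ 1) = q (φ y) := by
    intro b
    obtain ⟨x, rfl⟩ := Ideal.Quotient.mk_surjective b
    obtain ⟨y, hy⟩ := h.exists_compress x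
    refine ⟨y, ?_⟩
    rw [← hφ, ← hφ1] at hy
    have := Ideal.Quotient.eq_zero_iff_mem.mpr hy
    rw [map_sub, sub_eq_zero, map_mul, map_mul] at this
    exact this
  have hinj : ∀ y, q (φ y) = 0 → y = 0 := fun y hy =>
    h.eq_zero_of_mapDomain_mem (Ideal.Quotient.eq_zero_iff_mem.mp hy)
  obtain ⟨x, hx⟩ := hcomp r
  rw [← hφ1]
  change q (φ 1) * r * q (φ 1) = 0
  suffices x = 0 by rw [hx, this, map_zero, map_zero]
  have hxr : q (φ x) ∈ Ring.jacobson (MonoidAlgebra k M ⧸ setIdeal k S') := by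
    rw [← hx]
    exact Ideal.mul_mem_right _ _ (Ideal.mul_mem_left _ _ hr)
  have hxj : x ∈ Ring.jacobson (MonoidAlgebra k (SchutzenbergerGroup e)) := by
    rw [← Ideal.jacobson_bot, Ideal.mem_jacobson_iff] at hxr ⊢
    intro y
    -- The quasi-inverse `w` found in the quotient need not lie in the corner; its compression by
    -- `e` does, and still works.
    obtain ⟨w, hw⟩ := hxr (q (φ y))
    obtain ⟨z, hz⟩ := hcomp w
    refine ⟨z, ?_⟩
    rw [Submodule.mem_bot] at hw ⊢
    apply hinj
    have h1y : q (φ 1) * q (φ y) = q (φ y) := by rw [← map_mul, ← map_mul, one_mul]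
    have hx1 : q (φ x) * q (φ 1) = q (φ x) := by rw [← map_mul, ← map_mul, mul_one]
    have h11 : q (φ 1) * q (φ 1) = q (φ 1) := by rw [← map_mul, ← map_mul, mul_one]
    calc q (φ (z * y * x + z - 1))
        = q (φ z) * q (φ y) * q (φ x) + q (φ z) - q (φ 1) := by
          simp only [map_mul, map_add, map_sub]
      _ = q (φ 1) * w * (q (φ 1) * q (φ y)) * (q (φ x)) + q (φ 1) * w * q (φ 1)
            - q (φ 1) := by rw [← hz]; simp only [mul_assoc]
      _ = q (φ 1) * (w * q (φ y) * q (φ x) + w - 1) * q (φ 1) := by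
          rw [h1y]
          simp only [mul_add, mul_sub, add_mul, sub_mul, mul_one, mul_assoc, hx1, h11]
      _ = 0 := by rw [hw, mul_zero, zero_mul]
  rw [IsSemisimpleRing.jacobson_eq_bot] at hxj
  exact (Submodule.mem_bot _).mp hxj

theorem IsRegularLayer.exists_factor (h : IsRegularLayer S S' e) {m : M} (hm : m ∈ S)
    (hm' : m ∉ S') : ∃ a b : M, m = a * e * b := (h.jLe m hm hm').1

theorem IsRegularLayer.mul_mul_eq_zero [Finite M] (h : IsRegularLayer S S' e)
    (hcard : (Nat.card (SchutzenbergerGroup e) : k) ≠ 0) [(setIdeal k S').IsTwoSided]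
    {r : MonoidAlgebra k M ⧸ setIdeal k S'}
    (hr : r ∈ Ring.jacobson (MonoidAlgebra k M ⧸ setIdeal k S'))
    {x y : MonoidAlgebra k M} (hx : x ∈ setIdeal k S) (hy : y ∈ setIdeal k S) :
    Ideal.Quotient.mk (setIdeal k S') x * r * Ideal.Quotient.mk (setIdeal k S') y = 0 := by
  set q := Ideal.Quotient.mk (setIdeal k S') with hq
  refine setIdeal_induction h.ideal (P := fun x => q x * r * q y = 0) (by simp) ?_ ?_ hx
  · intro x x' hx hx'; rw [map_add, add_mul, add_mul, hx, hx', add_zero]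
  intro m hm s
  refine setIdeal_induction h.ideal (P := fun y => q (MonoidAlgebra.single m s) * r * q y = 0)
    (by simp) ?_ ?_ hy
  · intro x x' hx hx'; rw [map_add, mul_add, hx, hx', add_zero]
  intro m' hm' s'
  by_cases h1 : m ∈ S'
  · rw [Ideal.Quotient.eq_zero_iff_mem.mpr (single_mem_setIdeal h1 s), zero_mul, zero_mul]
  by_cases h2 : m' ∈ S'
  · rw [Ideal.Quotient.eq_zero_iff_mem.mpr (single_mem_setIdeal h2 s'), mul_zero]
  obtain ⟨a, b, rfl⟩ := h.exists_factor hm h1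
  obtain ⟨a', b', rfl⟩ := h.exists_factor hm' h2
  have hs : ∀ (a b : M) (s : k), q (MonoidAlgebra.single (a * e * b) s) =
      q (MonoidAlgebra.single a s) * q (MonoidAlgebra.single e 1) *
        q (MonoidAlgebra.single b 1) := by
    intro a b s
    simp only [← map_mul, MonoidAlgebra.single_mul_single, mul_one]
  have hz := h.compress_jacobson hcard (r := q (MonoidAlgebra.single b 1) * r *
    q (MonoidAlgebra.single a' s')) (Ideal.mul_mem_right _ _ (Ideal.mul_mem_left _ _ hr))
  calc _ = q (MonoidAlgebra.single a s) * (q (MonoidAlgebra.single e 1) *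
        (q (MonoidAlgebra.single b 1) * r * q (MonoidAlgebra.single a' s')) *
        q (MonoidAlgebra.single e 1)) * q (MonoidAlgebra.single b' 1) := by
        rw [hs, hs]; simp only [mul_assoc]
    _ = 0 := by rw [hz, mul_zero, zero_mul]

theorem IsRegularLayer.map_mul_map (h : IsRegularLayer S S' e) [(setIdeal k S').IsTwoSided]
    [(setIdeal k S).IsTwoSided] :
    (setIdeal k S).map (Ideal.Quotient.mk (setIdeal k S')) *
      (setIdeal k S).map (Ideal.Quotient.mk (setIdeal k S')) =
      (setIdeal k S).map (Ideal.Quotient.mk (setIdeal k S')) := by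
  refine le_antisymm Ideal.mul_le_right ?_
  set q := Ideal.Quotient.mk (setIdeal k S')
  intro y hy
  obtain ⟨x, hx, rfl⟩ :=
    (Ideal.mem_map_iff_of_surjective q Ideal.Quotient.mk_surjective).mp hy
  refine setIdeal_induction h.ideal
    (P := fun x => q x ∈ (setIdeal k S).map q * (setIdeal k S).map q) (by simp) ?_ ?_ hx
  · intro x x' hx hx'; rw [map_add]; exact add_mem hx hx'
  intro m hm r
  by_cases hm' : m ∈ S'
  · rw [Ideal.Quotient.eq_zero_iff_mem.mpr (single_mem_setIdeal hm' r)]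
    exact zero_mem _
  obtain ⟨a, b, rfl⟩ := h.exists_factor hm hm'
  have : MonoidAlgebra.single (a * e * b) r =
      MonoidAlgebra.single (a * e) r * MonoidAlgebra.single (e * b) 1 := by
    rw [MonoidAlgebra.single_mul_single, mul_one, ← mul_assoc, mul_assoc a e e, h.idem]
  rw [this, map_mul]
  exact Ideal.mul_mem_mul
    (Ideal.mem_map_of_mem q (single_mem_setIdeal (h.ideal.mul_left h.mem a) r))
    (Ideal.mem_map_of_mem q (single_mem_setIdeal (h.ideal.mul_right h.mem b) 1))

/-- The principal left ideal of an element, which determines its `𝓛`-class. -/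
def leftIdeal (m : M) : Set M := Set.range fun x : M => x * m

/-- Each `𝓛`-class of the layer has a representative `v j` that is `𝓡`-equivalent to `e`, with `v j
* w j = e`. Right multiplication by `w j` carries that class into `M e`, and by `v j` carries it
back. The form `τ j` is projection to the class followed by `w j`. -/
theorem IsRegularLayer.projective [Finite M] (h : IsRegularLayer S S' e)
    [(setIdeal k S').IsTwoSided] :
    Module.Projective (MonoidAlgebra k M ⧸ setIdeal k S')
      ((setIdeal k S).map (Ideal.Quotient.mk (setIdeal k S'))) := by
  classical
  let ι := {j : Set M // ∃ v, GreenR v e ∧ leftIdeal v = j}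
  have : Finite ι := Subtype.finite
  have : Fintype ι := Fintype.ofFinite ι
  choose v hvR hvj using fun j : ι => j.2
  choose w hw using fun j : ι => (greenR_iff.mp (hvR j)).2
  have hvS : ∀ j, v j ∈ S := fun j => h.ideal.of_jLe h.mem (hvR j).jLe
  -- elements of a given `𝓛`-class of the layer
  have hrep : ∀ (j : ι) (m : M), leftIdeal m = j.1 → m * w j * v j = m := by
    intro j m hm
    have hL : GreenL m (v j) := hm.trans (hvj j).symm
    obtain ⟨⟨c, rfl⟩, -⟩ := greenL_iff.mp hL
    obtain ⟨⟨d, hd⟩, -⟩ := greenR_iff.mp (hvR j)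
    rw [mul_assoc c, ← hw j, mul_assoc]
    congr 1
    conv_rhs => rw [hd]
    conv_lhs => rw [hd, ← mul_assoc, h.idem]
  have hnot : ∀ (j : ι) (m : M), leftIdeal m = j.1 → m ∉ S' := by
    intro j m hm
    have hL : GreenL m (v j) := hm.trans (hvj j).symm
    exact h.notMem_of_jLe ((hvR j).symm.jLe.trans hL.symm.jLe)
  have hex : ∀ m ∈ S, m ∉ S' → ∃ j : ι, leftIdeal m = j.1 := by
    intro m hm hm'
    obtain ⟨h1, h2⟩ := h.jLe m hm hm'
    obtain ⟨a, b, rfl⟩ := h1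
    have hR : GreenR (e * b) e := greenR_of_jLe_mul (by
      refine h2.trans ?_
      rw [mul_assoc]
      exact jLe_mul_left _ _)
    have hL : GreenL (a * e * b) (e * b) := by
      rw [mul_assoc] at h2 ⊢
      exact greenL_of_jLe_mul (hR.jLe.trans h2)
    exact ⟨⟨leftIdeal (e * b), e * b, hR, rfl⟩, hL⟩
  let τ : ι → MonoidAlgebra k M →+ MonoidAlgebra k M := fun j =>
    MonoidAlgebra.liftNC (MonoidAlgebra.singleOneRingHom : k →+* MonoidAlgebra k M).toAddMonoidHom
      (fun m => if leftIdeal m = j.1 then MonoidAlgebra.single (m * w j) 1 else 0)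
  have hτ : ∀ j m r, τ j (MonoidAlgebra.single m r) =
      if leftIdeal m = j.1 then MonoidAlgebra.single (m * w j) r else 0 := by
    intro j m r
    simp only [τ, MonoidAlgebra.liftNC_single]
    split_ifs
    · simp [MonoidAlgebra.singleOneRingHom, MonoidAlgebra.single_mul_single]
    · simp
  have hτ' : ∀ j m r, m ∈ S' → τ j (MonoidAlgebra.single m r) = 0 := fun j m r hm => by
    rw [hτ, if_neg fun hj => hnot j m hj hm]
  refine projective_map_mk_of_dualBasis (setIdeal k S') (setIdeal k S) τ
    (fun j => MonoidAlgebra.single (v j) 1) (fun j => single_mem_setIdeal (hvS j) 1) ?_ ?_ ?_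
  · intro j x hx
    refine setIdeal_induction h.ideal' (P := fun x => τ j x ∈ setIdeal k S') (by simp) ?_ ?_ hx
    · intro x y hx hy; rw [map_add]; exact add_mem hx hy
    · intro m hm r
      rw [hτ' j m r hm]
      exact zero_mem _
  · intro j a x hx
    refine setIdeal_induction h.ideal (P := fun x => τ j (a * x) - a * τ j x ∈ setIdeal k S')
      (by simp) ?_ ?_ hx
    · intro x y hx hy
      rw [mul_add, map_add, map_add, mul_add, add_sub_add_comm]
      exact add_mem hx hy
    intro m hm r
    induction a using MonoidAlgebra.induction_linear with
    | zero => simp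
    | add a b ha hb =>
      rw [add_mul, map_add, add_mul, add_sub_add_comm]
      exact add_mem ha hb
    | single g s =>
      rw [MonoidAlgebra.single_mul_single]
      by_cases hm' : m ∈ S'
      · rw [hτ' _ _ _ hm', hτ' _ _ _ (h.ideal'.mul_left hm' g)]
        simp
      by_cases hgm : g * m ∈ S'
      · rw [hτ' _ _ _ hgm, hτ, zero_sub, neg_mem_iff]
        split_ifs
        · rw [MonoidAlgebra.single_mul_single, ← mul_assoc]
          exact single_mem_setIdeal (h.ideal'.mul_right hgm _) _
        · simp
      -- Left multiplication that does not fall into `S'` stays in the same `𝓛`-class; this is why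
      -- `τ j` is left linear modulo `S'`.
      · have hL : leftIdeal (g * m) = leftIdeal m := greenL_of_jLe_mul
          ((h.jLe m hm hm').1.trans (h.jLe _ (h.ideal.mul_left hm g) hgm).2)
        rw [hτ, hτ, hL]
        split_ifs
        · rw [MonoidAlgebra.single_mul_single, mul_assoc, sub_self]
          exact zero_mem _
        · simp
  · intro x hx
    refine setIdeal_induction h.ideal
      (P := fun x => x - ∑ j, τ j x * MonoidAlgebra.single (v j) 1 ∈ setIdeal k S')
      (by simp) ?_ ?_ hx
    · intro x y hx hy
      simp only [map_add, add_mul, Finset.sum_add_distrib]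
      rw [add_sub_add_comm]
      exact add_mem hx hy
    intro m hm r
    by_cases hm' : m ∈ S'
    · simp only [hτ' _ _ _ hm', zero_mul, Finset.sum_const_zero, sub_zero]
      exact single_mem_setIdeal hm' r
    obtain ⟨j, hj⟩ := hex m hm hm'
    rw [Finset.sum_eq_single j]
    · rw [hτ, if_pos hj, MonoidAlgebra.single_mul_single, hrep j m hj, mul_one, sub_self]
      exact zero_mem _
    · intro j' _ hj'
      rw [hτ, if_neg fun h' => hj' (Subtype.ext (h'.symm.trans hj)), zero_mul]
    · simp

theorem IsRegularLayer.isHeredityIdeal [Finite M] (h : IsRegularLayer S S' e)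
    (hcard : (Nat.card (SchutzenbergerGroup e) : k) ≠ 0) [(setIdeal k S').IsTwoSided] :
    IsHeredityIdeal ((setIdeal k S).map (Ideal.Quotient.mk (setIdeal k S'))) := by
  have := setIdeal_isTwoSided (k := k) h.ideal
  refine ⟨inferInstance, h.map_mul_map, ?_, h.projective⟩
  intro x hx r hr y hy
  obtain ⟨x, hx', rfl⟩ := (Ideal.mem_map_iff_of_surjective _ Ideal.Quotient.mk_surjective).mp hx
  obtain ⟨y, hy', rfl⟩ := (Ideal.mem_map_iff_of_surjective _ Ideal.Quotient.mk_surjective).mp hy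
  exact h.mul_mul_eq_zero hcard hr hx' hy'

end Layer

/-! ### The heredity chain -/

section Chain

variable {M : Type*} [Monoid M] [Finite M] {k : Type*} [Field k]

/-- A nonempty monoid ideal contains a maximal `𝓙`-class. -/
theorem exists_isRegularLayer (hid : ∀ m : M, ∃ e : M, e * e = e ∧ JLe e m ∧ JLe m e) {S : Set M}
    (hS : IsMonoidIdeal S) (hne : S.Nonempty) : ∃ S' e, IsRegularLayer S S' e := by
  -- Counting the elements below `x` turns maximality in the `𝓙`-preorder into maximality of a
  -- number.
  obtain ⟨m, hmS, hmax⟩ := (Set.toFinite S).exists_maximalFor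
    (fun x => {y : M | JLe y x}.ncard) S hne
  obtain ⟨e, he, hem, hme⟩ := hid m
  refine ⟨{x ∈ S | ¬ JLe e x}, e, hS, ?_, fun x hx => hx.1, he, hS.of_jLe hmS hem,
    fun h => h.2 (JLe.refl e), ?_⟩
  · rintro x ⟨hx, hex⟩ a b
    exact ⟨hS x hx a b, fun h => hex (h.trans ⟨a, b, rfl⟩)⟩
  · intro x hx hx'
    have hex : JLe e x := by
      by_contra hn
      exact hx' ⟨hx, hn⟩
    have hsub : {y : M | JLe y m} ⊆ {y : M | JLe y x} := fun y hy => (hy.trans hme).trans hex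
    have heq := Set.eq_of_subset_of_ncard_le hsub (hmax hx (Set.ncard_le_ncard hsub))
    have hxm : JLe x m := by
      change x ∈ {y : M | JLe y m}
      rw [heq]
      exact JLe.refl x
    exact ⟨hxm.trans hme, hex⟩

/-- Induction on `|S|`: a maximal `𝓙`-class is split off, and the chain for the remaining `S'` is
prolonged by the span of `S` at index `n + 1`. -/
theorem exists_heredity_chain (hid : ∀ m : M, ∃ e : M, e * e = e ∧ JLe e m ∧ JLe m e)
    (hcard : ∀ e : M, (Nat.card (SchutzenbergerGroup e) : k) ≠ 0) (S : Set M)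
    (hS : IsMonoidIdeal S) :
    ∃ (n : ℕ) (J : ℕ → Ideal (MonoidAlgebra k M)) (_ : ∀ i, (J i).IsTwoSided),
      J 0 = ⊥ ∧ J n = setIdeal k S ∧ ∀ i < n, J i ≤ J (i + 1) ∧
        IsHeredityIdeal ((J (i + 1)).map (Ideal.Quotient.mk (J i))) := by
  induction hn : S.ncard using Nat.strong_induction_on generalizing S with
  | _ N ih =>
  rcases S.eq_empty_or_nonempty with rfl | hne
  · exact ⟨0, fun _ => ⊥, fun _ => inferInstance, rfl, setIdeal_empty.symm, by simp⟩
  obtain ⟨S', e, h⟩ := exists_isRegularLayer hid hS hne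
  have hlt : S'.ncard < N := by
    rw [← hn]
    exact Set.ncard_lt_ncard (h.subset.ssubset_of_mem_notMem h.mem h.notMem) (Set.toFinite S)
  obtain ⟨n, J, hJ, h0, hJn, hstep⟩ := ih _ hlt S' h.ideal' rfl
  have hS2 := setIdeal_isTwoSided (k := k) hS
  have hS2' := setIdeal_isTwoSided (k := k) h.ideal'
  have key : ∀ (I₁ I₂ K₁ K₂ : Ideal (MonoidAlgebra k M)) [I₁.IsTwoSided] [K₁.IsTwoSided],
      K₁ = I₁ → K₂ = I₂ → IsHeredityIdeal (I₂.map (Ideal.Quotient.mk I₁)) →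
      IsHeredityIdeal (K₂.map (Ideal.Quotient.mk K₁)) := by
    rintro I₁ I₂ _ _ _ _ rfl rfl h
    exact h
  have hle : ∀ i, i ≤ n → (if i ≤ n then J i else setIdeal k S) = J i := fun i hi => if_pos hi
  have hgt : (if n + 1 ≤ n then J (n + 1) else setIdeal k S) = setIdeal k S :=
    if_neg (Nat.not_succ_le_self n)
  have hT : ∀ i, (if i ≤ n then J i else setIdeal k S).IsTwoSided := fun i => by
    split_ifs
    · exact hJ i
    · exact hS2
  refine ⟨n + 1, fun i => if i ≤ n then J i else setIdeal k S, hT, ?_, hgt, ?_⟩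
  · exact (hle 0 (Nat.zero_le n)).trans h0
  intro i hi
  rcases Nat.lt_succ_iff_lt_or_eq.mp hi with hi | rfl
  · have := hstep i hi
    refine ⟨?_, key (J i) (J (i + 1)) _ _ (hle i hi.le) (hle (i + 1) hi) this.2⟩
    dsimp only
    rw [hle i hi.le, hle (i + 1) hi]
    exact this.1
  · refine ⟨?_, key (setIdeal k S') (setIdeal k S) _ _ ((hle i le_rfl).trans hJn) hgt
      (h.isHeredityIdeal (hcard e))⟩
    dsimp only
    rw [hle i le_rfl, hgt, hJn]
    exact setIdeal_mono h.subset

theorem isQuasiHereditary_of_idempotents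
    (hid : ∀ m : M, ∃ e : M, e * e = e ∧ JLe e m ∧ JLe m e)
    (hcard : ∀ e : M, (Nat.card (SchutzenbergerGroup e) : k) ≠ 0) :
    IsQuasiHereditary k (MonoidAlgebra k M) := by
  refine ⟨inferInstance, ?_⟩
  have := exists_heredity_chain (k := k) hid hcard Set.univ fun _ _ _ _ => Set.mem_univ _
  rwa [setIdeal_univ] at this

end Chain

end MonoidCell

theorem corollary4p4 (k : Type*) [Field k] (M : Type*) [Monoid M] [Finite M]
    (γ : MonoidCell.DClass M → M) (hγ : ∀ D, γ D ∈ D.carrier)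
    (hcell : ∀ D, MonoidCell.IsFullCellAlgebra k
      (MonoidAlgebra k (MonoidCell.SchutzenbergerGroup (γ D)))) :
    (MonoidCell.IsRegularMonoid M → MonoidCell.IsQuasiHereditary k (MonoidAlgebra k M)) ∧
    ((∀ D : MonoidCell.DClass M, ¬ MonoidCell.SqSubsetHat k D) →
      MonoidCell.IsQuasiHereditary k (MonoidAlgebra k M)) := by
  have hcard : ∀ e : M, (Nat.card (MonoidCell.SchutzenbergerGroup e) : k) ≠ 0 := by
    intro e
    have hD : MonoidCell.GreenD e (γ ⟨MonoidCell.dClass e, e, rfl⟩) :=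
      hγ ⟨MonoidCell.dClass e, e, rfl⟩
    -- The hypothesis concerns the chosen base points only. Since just the order of the group
    -- matters, equal sizes of `𝓗`-classes within a `𝓓`-class carry it over to `e`.
    rw [MonoidCell.card_schutzenbergerGroup, MonoidCell.card_hClass_eq_of_greenD hD,
      ← MonoidCell.card_schutzenbergerGroup]
    exact MonoidCell.card_ne_zero_of_isFullCellAlgebra k _ (hcell _)
  refine ⟨fun hreg => MonoidCell.isQuasiHereditary_of_idempotents (fun m => ?_) hcard,
    fun hsq => MonoidCell.isQuasiHereditary_of_idempotents
      (MonoidCell.exists_idempotent_of_not_sqSubsetHat k hsq) hcard⟩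
  obtain ⟨y, hy⟩ := hreg m
  exact MonoidCell.exists_idempotent_of_regular hy
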